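/- Throughout, $\|\cdot\|_\infty$ is the maximum norm (and the induced matrix norm), solutions are Carathéodory solutions, and $t_0\in\mathbb R$ is fixed. For $i\in\mathcal N=\{1,\dots,N\}$ consider agents $$\dot y_i=F_i(t,y_i,z_i)+\Gamma_i(t,w_i)u_i,\qquad \dot z_i=Z_i(t,z_i,y_i),\qquad w_i=W_i(y_i,z_i),$$ with $y_i,u_i\in\mathbb R^m$, $z_i\in\mathbb R^{n_i}$, $w_i\in\mathbb R^{m_i}$, coupled by $$u_i=\Gamma_i(t,w_i)^{-1}\sum_{j\in\mathcal N_i}\Big(\mu_{ij}^p\big(\nu_{ij}^p/\psi_{ij}^p(t)\big)\Big)_{p=1}^m,\qquad \nu_{ij}=y_j-y_i,$$ which is defined where $|\nu_{ij}^p|<\psi_{ij}^p(t)$ for all edges and all $p$. Assume: 1. $F_i,Z_i,\Gamma_i$ are defined for $t\ge t_0$, measurable in $t$, locally Lipschitz in $(y_i,z_i)$, respectively $w_i$, and bounded on compact sets of $(y_i,z_i)$, respectively $w_i$, uniformly in $t$; $W_i$ is locally Lipschitz. 2. $\Gamma_i(t,w)$ is invertible for all $t\ge t_0$ and $w$, and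 $\|\Gamma_i(t,w)^{-1}\|_\infty\le M_\Gamma$ for some constant $M_\Gamma$. 3. The graph $\mathcal G=(\mathcal N,\mathcal E)$ with $(j,i)\in\mathcal E\iff j\in\mathcal N_i$ is undirected and connected. 4. For every edge and $p\in\{1,\dots,m\}$: $\psi_{ij}^p=\psi_{ji}^p:[t_0,\infty)\to\mathbb R_{>0}$ is bounded and $C^1$ with bounded derivative; $\mu_{ij}^p:(-1,1)\to\mathbb R$ is continuous, $\mu_{ij}^p(r)\to\pm\infty$ as $r\to\pm1$, and $\mu_{ij}^p(-r)=-\mu_{ji}^p(r)$. 5. Let $d_{\mathcal G}$ be the diameter of $\mathcal G$ and $\Psi(t)=\max_{p}\max_{(j,i)\in\mathcal E}\psi_{ij}^p(t)$ (zero if there is nothing to maximize over). For every initial time $\tau\ge t_0$, every initial state, and all absolutely continuous inputs $e_i:[\tau,\infty)\to\mathbb R^m$ with $\|e_i(t)\|_\infty\le d_{\mathcal G}\Psi(t)$, the perturbed blended dynamics $$\dot s=\frac1N\sum_{i=1}^N F_i(t,s+e_i,z_i),\qquad \dot z_i=Z_i(t,z_i,s+e_i),\quad i\in\mathcal N,\tag{P}$$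 has a global solution. Assume moreover that (P), with state $x=(s,z_1,\dots,z_N)$ and input $e=(e_1,\dots,e_N)$, is $\delta$-ISS: for every initial time $\tau\ge t_0$, every initial state and every measurable, locally essentially bounded input it has a global solution, and there are $\beta\in\mathcal{KL}$, $\hat\gamma\in\mathcal K_\infty$, not depending on $\tau$, such that for any two such inputs $e,\hat e$ and corresponding solutions $x,\hat x$ on $[\tau,\infty)$, $$\|\hat x(t)-x(t)\|_\infty\le\beta(\|\hat x(\tau)-x(\tau)\|_\infty,t-\tau)+\hat\gamma\Big(\sup_{r\in[\tau,t)}\|\hat e(r)-e(r)\|_\infty\Big),\quad t\ge\tau .$$ Then for every decreasing $w:[0,\infty)\to(0,1]$ with $w(r)\to0$ as $r\to\infty$ there is $\gamma\in\mathcal K_\infty$ such that the following holds for all initial values $(y_i(t_0),z_i(t_0))_{i\in\mathcal N}$ with $|y_j^p(t_0)-y_i^p(t_0)|<\psi_{ij}^p(t_0)$ for all edges $(j,i)\in\mathcal E$ and all $p$. The coupled system has a solution on $[t_0,\infty)$ with these initial values, and the blended dynamics ((P) with $e\equiv0$) has a solution on $[t_0,\infty)$ with initial values $\hat s(t_0)=\frac1N\sum_i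 y_i(t_0)$, $\hat z_i(t_0)=z_i(t_0)$. All maximal solutions $(y_i,z_i)_{i}$ and $(\hat s,\hat z_1,\dots,\hat z_N)$ with these initial values are defined on $[t_0,\infty)$, and for all $i\in\mathcal N$ and $t\ge t_0$, $$\left\|\begin{bmatrix}y_i(t)\\ z_i(t)\end{bmatrix}-\begin{bmatrix}\hat s(t)\\ \hat z_i(t)\end{bmatrix}\right\|_\infty\le\gamma\Big(\sup_{r\in[t_0,t)}d_{\mathcal G}\Psi(r)\,w(t-r)\Big)+d_{\mathcal G}\Psi(t).$$ -/

import Mathlib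

open Filter Topology MeasureTheory Set

noncomputable section

namespace FunnelCoupling

/-! ### Carathéodory solutions -/

/-- `x` is a Carathéodory solution of `x' = f (t, x)` on `[a, ω)` whose graph stays in the domain
`D` of `f`: it is absolutely continuous on every compact subinterval `[a, T]` and satisfies the
equation almost everywhere. Only the values of `x` on `[a, ω)` matter. -/
structure IsSolutionOn {X : Type*} [NormedAddCommGroup X] [NormedSpace ℝ X]
    (f : ℝ → X → X) (D : Set (ℝ × X)) (a : ℝ) (ω : EReal) (x : ℝ → X) : Prop where
  mem_domain : ∀ t : ℝ, a ≤ t → (t : EReal) < ω → (t, x t) ∈ D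
  absolutelyContinuous : ∀ T : ℝ, a ≤ T → (T : EReal) < ω → AbsolutelyContinuousOnInterval x a T
  hasDerivAt : ∀ᵐ t : ℝ, a < t → (t : EReal) < ω → HasDerivAt x (f t (x t)) t

/-- `x` is a Carathéodory solution on `[a, ω)`, `a < ω ≤ ∞`, which has no proper extension to the
right. -/
structure IsMaximalSolution {X : Type*} [NormedAddCommGroup X] [NormedSpace ℝ X]
    (f : ℝ → X → X) (D : Set (ℝ × X)) (a : ℝ) (ω : EReal) (x : ℝ → X) : Prop where
  lt : (a : EReal) < ω
  isSolutionOn : IsSolutionOn f D a ω x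
  maximal : ∀ (ω' : EReal) (x' : ℝ → X), IsSolutionOn f D a ω' x' →
    (∀ t : ℝ, a ≤ t → (t : EReal) < ω → x' t = x t) → ω' ≤ ω

/-! ### Comparison functions and incremental input-to-state stability -/

/-- Class `𝒦`: continuous and strictly increasing on `[0, ∞)`, zero at zero. -/
structure ClassK (α : ℝ → ℝ) : Prop where
  continuousOn : ContinuousOn α (Ici 0)
  strictMonoOn : StrictMonoOn α (Ici 0)
  zero : α 0 = 0

/-- Class `𝒦_∞`: unbounded functions of class `𝒦`. -/
structure ClassKInfty (α : ℝ → ℝ) : Prop extends ClassK α where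
  tendsto_atTop : Tendsto α atTop atTop

/-- Class `𝒦ℒ`: `β(·, t)` is of class `𝒦` for every `t ≥ 0`, and `β(r, ·)` decreases to zero for
every `r ≥ 0`. -/
structure ClassKL (β : ℝ → ℝ → ℝ) : Prop where
  classK : ∀ t, 0 ≤ t → ClassK (fun r => β r t)
  antitoneOn : ∀ r, 0 ≤ r → AntitoneOn (β r) (Ici 0)
  tendsto_zero : ∀ r, 0 ≤ r → Tendsto (β r) atTop (𝓝 0)

/-- `u : [τ, ∞) → U` is (Lebesgue) measurable and locally essentially bounded. -/
structure IsAdmissibleInput {U : Type*} [NormedAddCommGroup U] (τ : ℝ) (u : ℝ → U) : Prop where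
  measurable : AEStronglyMeasurable u (volume.restrict (Ici τ))
  locallyBounded : ∀ T : ℝ, ∃ C : ℝ, ∀ᵐ t ∂(volume.restrict (Icc τ T)), ‖u t‖ ≤ C

/-- The system `x' = f (t, x, u)`, `t ∈ [t₀, ∞)`, is `δ`-ISS with `(β, γ)`: solutions exist globally
for every initial time `τ ≥ t₀`, every initial state and every admissible input, and any two of them
satisfy the incremental estimate. If the input difference is unbounded on `[τ, t)`, the right-hand
side of the estimate is infinite, and there is nothing to require; the supremum over the empty
interval is zero. -/
structure IsDeltaISS {X U : Type*} [NormedAddCommGroup X] [NormedSpace ℝ X] [NormedAddCommGroup U]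
    (t₀ : ℝ) (f : ℝ → X → U → X) (β : ℝ → ℝ → ℝ) (γ : ℝ → ℝ) : Prop where
  classKL : ClassKL β
  classKInfty : ClassKInfty γ
  global : ∀ τ, t₀ ≤ τ → ∀ (x₀ : X) (u : ℝ → U), IsAdmissibleInput τ u →
    ∃ x : ℝ → X, x τ = x₀ ∧ IsSolutionOn (fun t ξ => f t ξ (u t)) univ τ ⊤ x
  estimate : ∀ τ, t₀ ≤ τ → ∀ u u' : ℝ → U, IsAdmissibleInput τ u → IsAdmissibleInput τ u' →
    ∀ x x' : ℝ → X,
      IsSolutionOn (fun t ξ => f t ξ (u t)) univ τ ⊤ x →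
      IsSolutionOn (fun t ξ => f t ξ (u' t)) univ τ ⊤ x' →
      ∀ t, τ ≤ t → BddAbove ((fun s => ‖u' s - u s‖) '' Ico τ t) →
        ‖x' t - x t‖ ≤ β ‖x' τ - x τ‖ (t - τ) + γ (⨆ s : Ico τ t, ‖u' s - u s‖)

/-! ### The multi-agent system with edge-wise funnel coupling -/

/-- `ℝᵏ` with the maximum norm. -/
abbrev Vec (k : ℕ) : Type := Fin k → ℝ

/-- The data of `N` agents with outputs in `ℝᵐ`, internal states in `ℝ^(n i)` and introspective
outputs in `ℝ^(d i)`, of their communication graph, and of the coupling. The node `j` is in the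
neighbourhood `𝒩ᵢ` iff `graph.Adj i j`. -/
structure Network (N m : ℕ) (n d : Fin N → ℕ) where
  /-- the vector field `Fᵢ(t, y, z)` of the output -/
  F : (i : Fin N) → ℝ → Vec m → Vec (n i) → Vec m
  /-- the vector field `Zᵢ(t, z, y)` of the internal state -/
  Z : (i : Fin N) → ℝ → Vec (n i) → Vec m → Vec (n i)
  /-- the gain matrix `Γᵢ(t, w)` -/
  Γ : (i : Fin N) → ℝ → Vec (d i) → Matrix (Fin m) (Fin m) ℝ
  /-- the introspective output `Wᵢ(y, z)` -/
  W : (i : Fin N) → Vec m → Vec (n i) → Vec (d i)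
  /-- the (undirected) communication graph -/
  graph : SimpleGraph (Fin N)
  /-- the performance functions `ψᵢⱼᵖ(t)` -/
  ψ : Fin N → Fin N → Fin m → ℝ → ℝ
  /-- the coupling functions `μᵢⱼᵖ`, used on `(-1, 1)` only -/
  μ : Fin N → Fin N → Fin m → ℝ → ℝ

/-- The conditions on a time-dependent map `f(t, x)`, `t ≥ t₀`: measurable in `t`, locally Lipschitz
in `x`, and bounded on compact sets of `x`, uniformly in `t`. -/
structure IsRegular {E E' : Type*} [NormedAddCommGroup E] [NormedAddCommGroup E']
    (t₀ : ℝ) (f : ℝ → E → E') : Prop where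
  measurable : ∀ x, AEStronglyMeasurable (fun t => f t x) (volume.restrict (Ici t₀))
  locallyLipschitz : ∀ t, t₀ ≤ t → LocallyLipschitz (f t)
  bounded : ∀ K : Set E, IsCompact K → ∃ C : ℝ, ∀ t, t₀ ≤ t → ∀ x ∈ K, ‖f t x‖ ≤ C

namespace Network

variable {N m : ℕ} {n d : Fin N → ℕ}

/-- States `(yᵢ, zᵢ)ᵢ` of the network. -/
abbrev State (m : ℕ) (n : Fin N → ℕ) : Type := (i : Fin N) → Vec m × Vec (n i)

/-- States `(s, z₁, …, z_N)` of the blended dynamics. -/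
abbrev BlendedState (m : ℕ) (n : Fin N → ℕ) : Type := Vec m × ((i : Fin N) → Vec (n i))

/-- The edge coupling `uᵢⱼ(t, ν)`. -/
def edgeCoupling (S : Network N m n d) (i j : Fin N) (t : ℝ) (ν : Vec m) : Vec m :=
  fun p => S.μ i j p (ν p / S.ψ i j p t)

open Classical in
/-- The coupling law `uᵢ = Γᵢ(t, wᵢ)⁻¹ ∑_{j ∈ 𝒩ᵢ} uᵢⱼ(t, yⱼ - yᵢ)`, where `wᵢ = Wᵢ(yᵢ, zᵢ)`. -/
def coupling (S : Network N m n d) (t : ℝ) (x : State m n) (i : Fin N) : Vec m :=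
  (S.Γ i t (S.W i (x i).1 (x i).2))⁻¹.mulVec
    (∑ j with S.graph.Adj i j, S.edgeCoupling i j t ((x j).1 - (x i).1))

/-- The right-hand side of the network in closed loop with the coupling law. -/
def closedLoop (S : Network N m n d) (t : ℝ) (x : State m n) : State m n :=
  fun i => (S.F i t (x i).1 (x i).2
      + (S.Γ i t (S.W i (x i).1 (x i).2)).mulVec (S.coupling t x i),
    S.Z i t (x i).2 (x i).1)

/-- The set of `(t, x)` at which every output difference along an edge lies inside its funnel. This
is where the coupling law, whose coupling functions live on `(-1, 1)`, is defined. -/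
def funnel (S : Network N m n d) : Set (ℝ × State m n) :=
  {q | ∀ i j, S.graph.Adj i j → ∀ p, |(q.2 j).1 p - (q.2 i).1 p| < S.ψ i j p q.1}

/-- `Ψ(t)`, the maximum over `p` and over all edges of `ψᵢⱼᵖ(t)`
(zero by convention if there is nothing to maximize over). -/
def maxFunnel (S : Network N m n d) (t : ℝ) : ℝ :=
  ⨆ q : Fin m × S.graph.Dart, S.ψ q.2.fst q.2.snd q.1 t

/-- `d_𝒢 Ψ(t)`, with `d_𝒢` the diameter of the communication graph. -/
def syncBound (S : Network N m n d) (t : ℝ) : ℝ := (S.graph.diam : ℝ) * S.maxFunnel t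

/-- The right-hand side of the perturbed blended dynamics with state `(s, z₁, …, z_N)` and input
`(e₁, …, e_N)`. -/
def perturbedBlended (S : Network N m n d) (t : ℝ) (x : BlendedState m n) (e : Fin N → Vec m) :
    BlendedState m n :=
  ((N : ℝ)⁻¹ • ∑ i, S.F i t (x.1 + e i) (x.2 i), fun i => S.Z i t (x.2 i) (x.1 + e i))

/-- The right-hand side of the blended dynamics. -/
def blended (S : Network N m n d) (t : ℝ) (x : BlendedState m n) : BlendedState m n :=
  ((N : ℝ)⁻¹ • ∑ i, S.F i t x.1 (x.2 i), fun i => S.Z i t (x.2 i) x.1)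

/-- The initial value `((1/N) ∑ yᵢ, z₁, …, z_N)` of the blended dynamics. -/
def blendedInit (x : State m n) : BlendedState m n :=
  ((N : ℝ)⁻¹ • ∑ i, (x i).1, fun i => (x i).2)

section Assumptions

attribute [local instance] Matrix.linftyOpNormedAddCommGroup

/-- Open loop dynamics. -/
structure OpenLoop (S : Network N m n d) (t₀ : ℝ) : Prop where
  F : ∀ i, IsRegular t₀ (fun t (q : Vec m × Vec (n i)) => S.F i t q.1 q.2)
  Z : ∀ i, IsRegular t₀ (fun t (q : Vec m × Vec (n i)) => S.Z i t q.2 q.1)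
  Γ : ∀ i, IsRegular t₀ (S.Γ i)
  W : ∀ i, LocallyLipschitz (fun q : Vec m × Vec (n i) => S.W i q.1 q.2)

/-- Gain matrix: invertible, with inverse uniformly bounded in the matrix norm induced by the
maximum norm. -/
structure GainMatrix (S : Network N m n d) (t₀ : ℝ) : Prop where
  isUnit : ∀ i t, t₀ ≤ t → ∀ w, IsUnit (S.Γ i t w)
  bounded : ∃ M : ℝ, 0 < M ∧ ∀ i t, t₀ ≤ t → ∀ w, ‖(S.Γ i t w)⁻¹‖ ≤ M

end Assumptions

/-- Design functions: performance functions and coupling functions of the edges. -/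
structure DesignFunctions (S : Network N m n d) (t₀ : ℝ) : Prop where
  ψ_pos : ∀ i j, S.graph.Adj i j → ∀ p t, t₀ ≤ t → 0 < S.ψ i j p t
  ψ_bounded : ∀ i j, S.graph.Adj i j → ∀ p, ∃ C : ℝ, ∀ t, t₀ ≤ t → S.ψ i j p t ≤ C
  ψ_contDiff : ∀ i j, S.graph.Adj i j → ∀ p, ContDiffOn ℝ 1 (S.ψ i j p) (Ici t₀)
  ψ_deriv_bounded : ∀ i j, S.graph.Adj i j → ∀ p, ∃ C : ℝ, ∀ t, t₀ ≤ t →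
    |derivWithin (S.ψ i j p) (Ici t₀) t| ≤ C
  ψ_symm : ∀ i j, S.graph.Adj i j → ∀ p t, t₀ ≤ t → S.ψ i j p t = S.ψ j i p t
  μ_continuousOn : ∀ i j, S.graph.Adj i j → ∀ p, ContinuousOn (S.μ i j p) (Ioo (-1) 1)
  μ_atTop : ∀ i j, S.graph.Adj i j → ∀ p, Tendsto (S.μ i j p) (𝓝[<] 1) atTop
  μ_atBot : ∀ i j, S.graph.Adj i j → ∀ p, Tendsto (S.μ i j p) (𝓝[>] (-1)) atBot
  μ_symm : ∀ i j, S.graph.Adj i j → ∀ p, ∀ r ∈ Ioo (-1 : ℝ) 1, S.μ i j p (-r) = -S.μ j i p r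

/-- No finite escape time: from every initial time and state, the perturbed blended dynamics has a
global solution for all (locally) absolutely continuous inputs bounded by `d_𝒢 Ψ`. -/
def NoFiniteEscape (S : Network N m n d) (t₀ : ℝ) : Prop :=
  ∀ τ, t₀ ≤ τ → ∀ e : ℝ → Fin N → Vec m,
    (∀ T, τ ≤ T → AbsolutelyContinuousOnInterval e τ T) →
    (∀ t, τ ≤ t → ∀ i, ‖e t i‖ ≤ S.syncBound t) →
    ∀ x₀ : BlendedState m n, ∃ x : ℝ → BlendedState m n, x τ = x₀ ∧
      IsSolutionOn (fun t ξ => S.perturbedBlended t ξ (e t)) univ τ ⊤ x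

end Network

end FunnelCoupling

end

/-!
Summing the closed loop over the agents cancels the antisymmetric coupling, so the mean of the
outputs together with the internal states solves the perturbed blended dynamics, with the
deviations of the outputs from their mean as input. Along a solution inside the funnels this input
is bounded by `d_𝒢 Ψ`. Comparing with the unperturbed blended dynamics through the `δ`-ISS estimate,
started at every `τ ∈ [t₀, t]`, and optimizing over `τ` gives the gain with fading memory.

It remains to exclude a finite escape time `b`. The `δ`-ISS property keeps the solution bounded up
to `b`. The energy of each output component dissipates the coupling forces, so these are integrable
and the outputs converge. Suppose that some edge differences reach the boundary of their funnels
at `b`. The signed indicators of these edges have a convex hull which avoids zero, since the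
output differences themselves separate them, so its point of least norm is a potential whose
weighted sum of outputs decreases at infinite rate, although it converges at `b`.
-/

noncomputable section

namespace FunnelCoupling

/-! ### Absolutely continuous functions -/

section AbsolutelyContinuous

variable {X Y : Type*} [NormedAddCommGroup X] [NormedAddCommGroup Y]

theorem absolutelyContinuous_comp_monotone {f : ℝ → X} {φ : ℝ → ℝ} {a b c d : ℝ}
    (hf : AbsolutelyContinuousOnInterval f a b) (hφ : Monotone φ) (hL : LipschitzWith 1 φ)
    (hmaps : MapsTo φ (uIcc c d) (uIcc a b)) :
    AbsolutelyContinuousOnInterval (fun t => f (φ t)) c d := by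
  rw [absolutelyContinuousOnInterval_iff] at hf ⊢
  intro ε hε
  obtain ⟨δ, hδ, hf⟩ := hf ε hε
  refine ⟨δ, hδ, fun I hI hlength => hf (I.1, fun i => (φ (I.2 i).1, φ (I.2 i).2)) ⟨?_, ?_⟩ ?_⟩
  · exact fun i hi => ⟨hmaps (hI.1 i hi).1, hmaps (hI.1 i hi).2⟩
  · intro i hi j hj hij
    have hdisjoint := hI.2 hi hj hij
    simp only [Function.onFun, uIoc, Ioc_disjoint_Ioc] at hdisjoint ⊢
    simpa only [hφ.map_min, hφ.map_max] using hφ hdisjoint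
  · refine (Finset.sum_le_sum fun i _ => ?_).trans_lt hlength
    simpa using hL.dist_le_mul (I.2 i).1 (I.2 i).2

theorem absolutelyContinuous_comp_lipschitz {f : ℝ → X} {φ : X → Y} {K : NNReal} {a b : ℝ}
    (hφ : LipschitzWith K φ) (hf : AbsolutelyContinuousOnInterval f a b) :
    AbsolutelyContinuousOnInterval (fun t => φ (f t)) a b := by
  have hsum := Filter.Tendsto.const_mul (K : ℝ) hf
  rw [mul_zero] at hsum
  refine squeeze_zero (fun _ => Finset.sum_nonneg fun _ _ => dist_nonneg) (fun I => ?_) hsum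
  rw [Finset.mul_sum]
  exact Finset.sum_le_sum fun i _ => hφ.dist_le_mul _ _

theorem absolutelyContinuous_congr {f g : ℝ → X} {a b : ℝ}
    (hf : AbsolutelyContinuousOnInterval f a b) (h : EqOn g f (uIcc a b)) :
    AbsolutelyContinuousOnInterval g a b := by
  rw [absolutelyContinuousOnInterval_iff] at hf ⊢
  intro ε hε
  obtain ⟨δ, hδ, hf⟩ := hf ε hε
  refine ⟨δ, hδ, fun I hI hlength => ?_⟩
  rw [Finset.sum_congr rfl fun i hi => by rw [h (hI.1 i hi).1, h (hI.1 i hi).2]]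
  exact hf I hI hlength

theorem absolutelyContinuous_const (c : X) (a b : ℝ) :
    AbsolutelyContinuousOnInterval (fun _ => c) a b :=
  ((LipschitzWith.const c).lipschitzOnWith (s := uIcc a b)).absolutelyContinuousOnInterval

theorem absolutelyContinuous_sum {ι : Type*} (s : Finset ι) {f : ι → ℝ → X} {a b : ℝ}
    (hf : ∀ i ∈ s, AbsolutelyContinuousOnInterval (f i) a b) :
    AbsolutelyContinuousOnInterval (∑ i ∈ s, f i) a b :=
  Finset.sum_induction _ (AbsolutelyContinuousOnInterval · a b) (fun _ _ hf hg => hf.add hg)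
    (absolutelyContinuous_const 0 a b) hf

theorem piecewise_Iic_of_le {α : Type*} {f g : ℝ → α} {b t : ℝ} (h : t ≤ b) :
    (Iic b).piecewise f g t = f t :=
  piecewise_eq_of_mem _ _ _ h

theorem piecewise_Iic_of_ge {α : Type*} {f g : ℝ → α} {b t : ℝ} (hfg : f b = g b) (h : b ≤ t) :
    (Iic b).piecewise f g t = g t := by
  rcases h.eq_or_lt with rfl | h
  · rw [piecewise_Iic_of_le le_rfl, hfg]
  · exact piecewise_eq_of_notMem _ _ _ h.not_ge

theorem absolutelyContinuous_piecewise {f g : ℝ → X} {a b c : ℝ} (hab : a ≤ b) (hbc : b ≤ c)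
    (hf : AbsolutelyContinuousOnInterval f a b) (hg : AbsolutelyContinuousOnInterval g b c)
    (hfg : f b = g b) : AbsolutelyContinuousOnInterval ((Iic b).piecewise f g) a c := by
  have hf' : AbsolutelyContinuousOnInterval (fun t => f (min t b)) a c := by
    refine absolutelyContinuous_comp_monotone hf (fun x y h => min_le_min_right b h)
      (LipschitzWith.id.min_const b) fun t ht => ?_
    rw [uIcc_of_le (hab.trans hbc)] at ht
    rw [uIcc_of_le hab]
    exact ⟨le_min ht.1 hab, min_le_right _ _⟩
  have hg' : AbsolutelyContinuousOnInterval (fun t => g (max t b)) a c := by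
    refine absolutelyContinuous_comp_monotone hg (fun x y h => max_le_max_right b h)
      (LipschitzWith.id.max_const b) fun t ht => ?_
    rw [uIcc_of_le (hab.trans hbc)] at ht
    rw [uIcc_of_le hbc]
    exact ⟨le_max_right _ _, max_le ht.2 hbc⟩
  refine absolutelyContinuous_congr ((hf'.add hg').sub (absolutelyContinuous_const (g b) a c)) ?_
  intro t _
  simp only [Pi.sub_apply, Pi.add_apply]
  rcases le_total t b with h | h
  · rw [piecewise_Iic_of_le h, min_eq_left h, max_eq_right h, add_sub_cancel_right]
  · rw [piecewise_Iic_of_ge hfg h, min_eq_right h, max_eq_left h, hfg, add_sub_cancel_left]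

end AbsolutelyContinuous

/-! ### Left limits -/

section LeftLimits

variable {X : Type*} [NormedAddCommGroup X]

theorem lipschitzOnWith_update_of_tendsto {f : ℝ → X} {s b : ℝ} {l : X} {M : NNReal}
    (hf : LipschitzOnWith M f (Ico s b)) (hsb : s < b) (hl : Tendsto f (𝓝[<] b) (𝓝 l)) :
    LipschitzOnWith M (Function.update f b l) (Icc s b) := by
  have hfar : ∀ p ∈ Ico s b, dist l (f p) ≤ M * dist b p := by
    intro p hp
    refine le_of_tendsto_of_tendsto (hl.dist tendsto_const_nhds)
      (((continuous_id.dist continuous_const).const_mul (M : ℝ)).tendsto b |>.mono_left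
        nhdsWithin_le_nhds) ?_
    filter_upwards [Ioo_mem_nhdsLT hsb] with r hr
    exact hf.dist_le_mul r ⟨hr.1.le, hr.2⟩ p hp
  refine LipschitzOnWith.of_dist_le_mul fun q hq p hp => ?_
  rcases hq.2.eq_or_lt with rfl | hqb <;> rcases hp.2.eq_or_lt with rfl | hpb
  · simp
  · simpa [hpb.ne] using hfar p ⟨hp.1, hpb⟩
  · simpa [hqb.ne, dist_comm] using hfar q ⟨hq.1, hqb⟩
  · simpa [hpb.ne, hqb.ne] using hf.dist_le_mul q ⟨hq.1, hqb⟩ p ⟨hp.1, hpb⟩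

theorem exists_tendsto_of_norm_sub_le_sub [CompleteSpace X] {f : ℝ → X} {h : ℝ → ℝ} {a b C : ℝ}
    (hab : a < b) (hle : ∀ s ∈ Ico a b, ∀ t ∈ Ico s b, ‖f t - f s‖ ≤ h t - h s)
    (hC : ∀ t ∈ Ico a b, h t ≤ C) : ∃ l, Tendsto f (𝓝[<] b) (𝓝 l) := by
  have hmono : MonotoneOn h (Ioo a b) := fun s hs t ht hst =>
    sub_nonneg.1 ((norm_nonneg _).trans (hle s ⟨hs.1.le, hs.2⟩ t ⟨hst, ht.2⟩))
  have hlim := hmono.tendsto_nhdsWithin_Ioo_left (nonempty_Ioo.2 hab)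
    ⟨C, by rintro _ ⟨t, ht, rfl⟩; exact hC t ⟨ht.1.le, ht.2⟩⟩
  refine cauchy_map_iff_exists_tendsto.1 (Metric.cauchy_iff.2 ⟨inferInstance, fun ε hε => ?_⟩)
  obtain ⟨V, hV, hVε⟩ := (Metric.cauchy_iff.1 hlim.cauchy_map).2 ε hε
  refine ⟨f '' (h ⁻¹' V ∩ Ioo a b),
    image_mem_map (inter_mem hV (Ioo_mem_nhdsLT hab)), ?_⟩
  rintro _ ⟨t, ht, rfl⟩ _ ⟨s, hs, rfl⟩
  wlog hst : s ≤ t generalizing s t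
  · simpa only [dist_comm] using this s hs t ht (le_of_not_ge hst)
  calc dist (f t) (f s) ≤ h t - h s := by
        rw [dist_eq_norm]
        exact hle s ⟨hs.2.1.le, hs.2.2⟩ t ⟨hst, ht.2.2⟩
    _ ≤ dist (h t) (h s) := le_abs_self _
    _ < ε := hVε _ ht.1 _ hs.1

end LeftLimits

/-! ### Almost everywhere derivatives -/

section HasAEDerivOn

variable {X Y : Type*} [NormedAddCommGroup X] [NormedSpace ℝ X] [NormedAddCommGroup Y]
  [NormedSpace ℝ Y]

/-- `f` is absolutely continuous on `[a, b]` with derivative `f'` almost everywhere on `(a, b)`. In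
finite dimension this says that `f` is an indefinite integral of `f'`. -/
structure HasAEDerivOn (f f' : ℝ → X) (a b : ℝ) : Prop where
  absolutelyContinuous : AbsolutelyContinuousOnInterval f a b
  hasDerivAt : ∀ᵐ t, t ∈ Ioo a b → HasDerivAt f (f' t) t

namespace HasAEDerivOn

variable {f f' g g' : ℝ → X} {a b c : ℝ}

theorem mono (hf : HasAEDerivOn f f' a b) {s t : ℝ} (has : a ≤ s) (hst : s ≤ t) (htb : t ≤ b) :
    HasAEDerivOn f f' s t where
  absolutelyContinuous := hf.absolutelyContinuous.mono (by
    rw [uIcc_of_le hst, uIcc_of_le (has.trans (hst.trans htb))]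
    exact Icc_subset_Icc has htb)
  hasDerivAt := by
    filter_upwards [hf.hasDerivAt] with r hr hmem
    exact hr (Ioo_subset_Ioo has htb hmem)

theorem congr (hf : HasAEDerivOn f f' a b) (h : ∀ t ∈ uIcc a b, g t = f t) :
    HasAEDerivOn g f' a b where
  absolutelyContinuous := absolutelyContinuous_congr hf.absolutelyContinuous h
  hasDerivAt := by
    filter_upwards [hf.hasDerivAt] with t ht hmem
    refine (ht hmem).congr_of_eventuallyEq ?_
    filter_upwards [Ioo_mem_nhds hmem.1 hmem.2] with r hr
    exact h r (Icc_subset_uIcc (Ioo_subset_Icc_self hr))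

theorem congr_deriv (hf : HasAEDerivOn f f' a b) (h : ∀ t ∈ Ioo a b, f' t = g' t) :
    HasAEDerivOn f g' a b where
  absolutelyContinuous := hf.absolutelyContinuous
  hasDerivAt := by
    filter_upwards [hf.hasDerivAt] with t ht hmem
    exact h t hmem ▸ ht hmem

theorem sub (hf : HasAEDerivOn f f' a b) (hg : HasAEDerivOn g g' a b) :
    HasAEDerivOn (fun t => f t - g t) (fun t => f' t - g' t) a b where
  absolutelyContinuous := hf.absolutelyContinuous.sub hg.absolutelyContinuous
  hasDerivAt := by
    filter_upwards [hf.hasDerivAt, hg.hasDerivAt] with t hft hgt hmem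
    exact (hft hmem).sub (hgt hmem)

theorem sum {ι : Type*} (s : Finset ι) {f f' : ι → ℝ → X}
    (hf : ∀ i ∈ s, HasAEDerivOn (f i) (f' i) a b) :
    HasAEDerivOn (fun t => ∑ i ∈ s, f i t) (fun t => ∑ i ∈ s, f' i t) a b where
  absolutelyContinuous := by
    convert absolutelyContinuous_sum s fun i hi => (hf i hi).absolutelyContinuous
    exact (Finset.sum_apply _ _ _).symm
  hasDerivAt := by
    have hall := (Filter.eventually_all_finset s).2 fun i hi => (hf i hi).hasDerivAt
    filter_upwards [hall] with t ht hmem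
    exact HasDerivAt.fun_sum fun i hi => ht i hi hmem

theorem clm_comp (hf : HasAEDerivOn f f' a b) (φ : X →L[ℝ] Y) :
    HasAEDerivOn (fun t => φ (f t)) (fun t => φ (f' t)) a b where
  absolutelyContinuous := absolutelyContinuous_comp_lipschitz φ.lipschitz hf.absolutelyContinuous
  hasDerivAt := by
    filter_upwards [hf.hasDerivAt] with t ht hmem
    exact φ.hasFDerivAt.comp_hasDerivAt t (ht hmem)

theorem const_mul {f f' : ℝ → ℝ} (hf : HasAEDerivOn f f' a b) (k : ℝ) :
    HasAEDerivOn (fun t => k * f t) (fun t => k * f' t) a b where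
  absolutelyContinuous := hf.absolutelyContinuous.const_mul k
  hasDerivAt := by
    filter_upwards [hf.hasDerivAt] with t ht hmem
    exact (ht hmem).const_mul k

theorem sq {f f' : ℝ → ℝ} (hf : HasAEDerivOn f f' a b) :
    HasAEDerivOn (fun t => f t ^ 2) (fun t => 2 * f t * f' t) a b where
  absolutelyContinuous := by
    simp only [pow_two]
    exact hf.absolutelyContinuous.mul hf.absolutelyContinuous
  hasDerivAt := by
    filter_upwards [hf.hasDerivAt] with t ht hmem
    simpa using (ht hmem).fun_pow 2

theorem piecewise (hab : a ≤ b) (hbc : b ≤ c) (hf : HasAEDerivOn f f' a b)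
    (hg : HasAEDerivOn g g' b c) (hfg : f b = g b) :
    HasAEDerivOn ((Iic b).piecewise f g) ((Iic b).piecewise f' g') a c where
  absolutelyContinuous :=
    absolutelyContinuous_piecewise hab hbc hf.absolutelyContinuous hg.absolutelyContinuous hfg
  hasDerivAt := by
    filter_upwards [hf.hasDerivAt, hg.hasDerivAt, Measure.ae_ne volume b] with t hft hgt hne hmem
    rcases hne.lt_or_gt with h | h
    · rw [piecewise_Iic_of_le h.le]
      refine (hft ⟨hmem.1, h⟩).congr_of_eventuallyEq ?_
      filter_upwards [Iio_mem_nhds h] with r hr using piecewise_Iic_of_le (mem_Iio.1 hr).le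
    · rw [piecewise_eq_of_notMem (Iic b) f' g' h.not_ge]
      refine (hgt ⟨h, hmem.2⟩).congr_of_eventuallyEq ?_
      filter_upwards [Ioi_mem_nhds h] with r hr using piecewise_Iic_of_ge hfg (mem_Ioi.1 hr).le

theorem sub_le_sub {f f' g g' : ℝ → ℝ} (hf : HasAEDerivOn f f' a b) (hg : HasAEDerivOn g g' a b)
    (hab : a ≤ b) (hle : ∀ t ∈ Ioo a b, f' t ≤ g' t) : f b - f a ≤ g b - g a := by
  have hgf := hg.sub hf
  have hint : ∫ t in a..b, deriv (fun t => g t - f t) t = _ :=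
    hgf.absolutelyContinuous.integral_deriv_eq_sub
  have hnonneg : 0 ≤ ∫ t in a..b, deriv (fun t => g t - f t) t := by
    refine intervalIntegral.integral_nonneg_of_ae_restrict hab ?_
    rw [Filter.EventuallyLE, ← Measure.restrict_congr_set Ioo_ae_eq_Icc,
      ae_restrict_iff' measurableSet_Ioo]
    filter_upwards [hgf.hasDerivAt] with t ht hmem
    simpa [(ht hmem).deriv] using hle t hmem
  linarith

theorem norm_sub_le_sub {h h' : ℝ → ℝ} (hf : HasAEDerivOn f f' a b) (hh : HasAEDerivOn h h' a b)
    (hab : a ≤ b) (hle : ∀ t ∈ Ioo a b, ‖f' t‖ ≤ h' t) : ‖f b - f a‖ ≤ h b - h a := by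
  obtain ⟨φ, hφ, hφ'⟩ := exists_dual_vector'' ℝ (f b - f a)
  calc ‖f b - f a‖ = φ (f b) - φ (f a) := by rw [← map_sub, hφ', RCLike.ofReal_real_eq_id, id]
    _ ≤ h b - h a := (hf.clm_comp φ).sub_le_sub hh hab fun t ht => calc
        φ (f' t) ≤ ‖φ (f' t)‖ := Real.le_norm_self _
        _ ≤ 1 * ‖f' t‖ := φ.le_of_opNorm_le hφ _
        _ ≤ h' t := by simpa using hle t ht

end HasAEDerivOn

theorem HasAEDerivOn.of_contDiffOn {f : ℝ → X} {a b : ℝ} (hab : a ≤ b)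
    (hf : ContDiffOn ℝ 1 f (Ici a)) : HasAEDerivOn f (derivWithin f (Ici a)) a b where
  absolutelyContinuous := by
    refine ContDiffOn.absolutelyContinuousOnInterval (hf.mono ?_)
    exact (uIcc_of_le hab).trans_subset Icc_subset_Ici_self
  hasDerivAt := Eventually.of_forall fun t ht =>
    ((hf.differentiableOn one_ne_zero t ht.1.le).hasDerivWithinAt).hasDerivAt (Ici_mem_nhds ht.1)

theorem hasAEDerivOn_const_mul (k a b : ℝ) : HasAEDerivOn (fun t => k * t) (fun _ => k) a b where
  absolutelyContinuous :=
    ((LipschitzWith.id (α := ℝ)).lipschitzOnWith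
      (s := uIcc a b)).absolutelyContinuousOnInterval.const_mul k
  hasDerivAt := Eventually.of_forall fun t _ => by simpa using (hasDerivAt_id t).const_mul k

theorem HasAEDerivOn.norm_sub_le {f f' : ℝ → X} {a b M : ℝ} (hf : HasAEDerivOn f f' a b)
    (hab : a ≤ b) (hM : ∀ t ∈ Ioo a b, ‖f' t‖ ≤ M) : ‖f b - f a‖ ≤ M * (b - a) :=
  (hf.norm_sub_le_sub (hasAEDerivOn_const_mul M a b) hab hM).trans_eq (mul_sub M b a).symm

theorem ae_hasDerivAt_of_forall_lt {f f' : ℝ → X} {a : ℝ} {ω : EReal}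
    (hf : ∀ T : ℝ, a ≤ T → (T : EReal) < ω → HasAEDerivOn f f' a T) :
    ∀ᵐ t : ℝ, a < t → (t : EReal) < ω → HasDerivAt f (f' t) t := by
  have hrat : ∀ q : ℚ, ∀ᵐ t : ℝ, a < t → t < (q : ℝ) → ((q : ℝ) : EReal) < ω →
      HasDerivAt f (f' t) t := by
    intro q
    by_cases hq : a ≤ q ∧ ((q : ℝ) : EReal) < ω
    · filter_upwards [(hf q hq.1 hq.2).hasDerivAt] with t ht hat htq _
      exact ht ⟨hat, htq⟩
    · exact Eventually.of_forall fun t hat htq hqω => (hq ⟨(hat.trans htq).le, hqω⟩).elim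
  filter_upwards [ae_all_iff.2 hrat] with t ht hat htω
  obtain ⟨q, htq, hqω⟩ := EReal.lt_iff_exists_rat_btwn.1 htω
  exact ht q hat (EReal.coe_lt_coe_iff.1 htq) hqω

theorem HasAEDerivOn.update_of_tendsto {f f' : ℝ → X} {a s b : ℝ} {l : X} {M : NNReal}
    (hf : ∀ T ∈ Ico a b, HasAEDerivOn f f' a T) (hs : s ∈ Ico a b)
    (hM : ∀ t ∈ Ico s b, ‖f' t‖ ≤ M) (hl : Tendsto f (𝓝[<] b) (𝓝 l)) :
    HasAEDerivOn (Function.update f b l) f' a b where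
  absolutelyContinuous := by
    have hLip : LipschitzOnWith M f (Ico s b) := by
      refine LipschitzOnWith.of_dist_le_mul fun q hq p hp => ?_
      wlog hpq : p ≤ q generalizing p q
      · simpa only [dist_comm] using this p hp q hq (le_of_not_ge hpq)
      have hpq' := (hf q ⟨hs.1.trans hq.1, hq.2⟩).mono (hs.1.trans hp.1) hpq le_rfl
      rw [dist_eq_norm, Real.dist_eq, abs_of_nonneg (sub_nonneg.2 hpq)]
      exact hpq'.norm_sub_le hpq fun t ht => hM t ⟨hp.1.trans ht.1.le, ht.2.trans hq.2⟩
    have hend : AbsolutelyContinuousOnInterval (Function.update f b l) s b := by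
      refine LipschitzOnWith.absolutelyContinuousOnInterval (K := M) ?_
      rw [uIcc_of_le hs.2.le]
      exact lipschitzOnWith_update_of_tendsto hLip hs.2 hl
    refine absolutelyContinuous_congr (absolutelyContinuous_piecewise hs.1 hs.2.le
      (hf s hs).absolutelyContinuous hend (Function.update_of_ne hs.2.ne _ _).symm) fun t _ => ?_
    rcases le_or_gt t s with h | h
    · rw [piecewise_Iic_of_le h, Function.update_of_ne (h.trans_lt hs.2).ne]
    · rw [piecewise_eq_of_notMem (Iic s) _ _ h.not_ge]
  hasDerivAt := by
    filter_upwards [ae_hasDerivAt_of_forall_lt (ω := (b : EReal)) fun T haT hTb =>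
      hf T ⟨haT, EReal.coe_lt_coe_iff.1 hTb⟩] with t ht hmem
    refine (ht hmem.1 (EReal.coe_lt_coe_iff.2 hmem.2)).congr_of_eventuallyEq ?_
    filter_upwards [Iio_mem_nhds hmem.2] with r hr using Function.update_of_ne (ne_of_lt hr) _ _

end HasAEDerivOn

/-! ### Carathéodory solutions -/

section Solutions

variable {X : Type*} [NormedAddCommGroup X] [NormedSpace ℝ X] {f : ℝ → X → X} {D : Set (ℝ × X)}
  {a : ℝ} {ω : EReal} {x y : ℝ → X}

theorem isSolutionOn_iff : IsSolutionOn f D a ω x ↔ ∀ T : ℝ, a ≤ T → (T : EReal) < ω →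
    (T, x T) ∈ D ∧ HasAEDerivOn x (fun t => f t (x t)) a T where
  mp h T haT hTω := by
    refine ⟨h.mem_domain T haT hTω, h.absolutelyContinuous T haT hTω, ?_⟩
    filter_upwards [h.hasDerivAt] with t ht hmem
    exact ht hmem.1 ((EReal.coe_lt_coe_iff.2 hmem.2).trans hTω)
  mpr h :=
    { mem_domain := fun T haT hTω => (h T haT hTω).1
      absolutelyContinuous := fun T haT hTω => (h T haT hTω).2.absolutelyContinuous
      hasDerivAt := ae_hasDerivAt_of_forall_lt fun T haT hTω => (h T haT hTω).2 }

namespace IsSolutionOn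

theorem hasAEDerivOn (h : IsSolutionOn f D a ω x) {T : ℝ} (haT : a ≤ T) (hTω : (T : EReal) < ω) :
    HasAEDerivOn x (fun t => f t (x t)) a T :=
  (isSolutionOn_iff.1 h T haT hTω).2

theorem continuousOn (h : IsSolutionOn f D a ω x) {T : ℝ} (haT : a ≤ T) (hTω : (T : EReal) < ω) :
    ContinuousOn x (Icc a T) :=
  uIcc_of_le haT ▸ (h.absolutelyContinuous T haT hTω).continuousOn

theorem restrict (h : IsSolutionOn f D a ω x) {b : ℝ} {ω' : EReal} (hab : a ≤ b) (hω : ω' ≤ ω) :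
    IsSolutionOn f D b ω' x :=
  isSolutionOn_iff.2 fun T hbT hTω =>
    ⟨h.mem_domain T (hab.trans hbT) (hTω.trans_le hω),
      (h.hasAEDerivOn (hab.trans hbT) (hTω.trans_le hω)).mono hab hbT le_rfl⟩

theorem congr (h : IsSolutionOn f D a ω x)
    (hyx : ∀ t : ℝ, a ≤ t → (t : EReal) < ω → y t = x t) : IsSolutionOn f D a ω y := by
  refine isSolutionOn_iff.2 fun T haT hTω => ⟨?_, ?_⟩
  · exact (hyx T haT hTω).symm ▸ h.mem_domain T haT hTω
  · have hyx' : ∀ t ∈ Icc a T, y t = x t := fun t ht =>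
      hyx t ht.1 ((EReal.coe_le_coe_iff.2 ht.2).trans_lt hTω)
    refine ((h.hasAEDerivOn haT hTω).congr ((uIcc_of_le haT).symm ▸ hyx')).congr_deriv ?_
    intro t ht
    rw [hyx' t (Ioo_subset_Icc_self ht)]

theorem congr_rhs (h : IsSolutionOn f D a ω x) {g : ℝ → X → X} {D' : Set (ℝ × X)}
    (hD : ∀ t : ℝ, a ≤ t → (t : EReal) < ω → (t, x t) ∈ D')
    (hg : ∀ t : ℝ, a ≤ t → (t : EReal) < ω → g t (x t) = f t (x t)) :
    IsSolutionOn g D' a ω x :=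
  isSolutionOn_iff.2 fun T haT hTω => ⟨hD T haT hTω, (h.hasAEDerivOn haT hTω).congr_deriv
    fun t ht => (hg t ht.1.le ((EReal.coe_lt_coe_iff.2 ht.2).trans hTω)).symm⟩

theorem piecewise {b : ℝ} (hab : a ≤ b) (hD : ∀ t ∈ Icc a b, (t, x t) ∈ D)
    (hx : HasAEDerivOn x (fun t => f t (x t)) a b) (hy : IsSolutionOn f D b ω y)
    (hxy : x b = y b) : IsSolutionOn f D a ω ((Iic b).piecewise x y) := by
  refine isSolutionOn_iff.2 fun T haT hTω => ?_
  rcases le_or_gt b T with hbT | hTb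
  · rw [piecewise_Iic_of_ge hxy hbT]
    refine ⟨hy.mem_domain T hbT hTω,
      (hx.piecewise hab hbT (hy.hasAEDerivOn hbT hTω) hxy).congr_deriv fun t _ => ?_⟩
    by_cases ht : t ≤ b
    · simp only [piecewise_Iic_of_le ht]
    · simp only [piecewise_eq_of_notMem (Iic b) _ _ ht]
  · rw [piecewise_Iic_of_le hTb.le]
    refine ⟨hD T ⟨haT, hTb.le⟩, ((hx.mono le_rfl haT hTb.le).congr ?_).congr_deriv ?_⟩
    · intro t ht
      exact piecewise_Iic_of_le (((uIcc_of_le haT).subset ht).2.trans hTb.le)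
    · intro t ht
      rw [piecewise_Iic_of_le (ht.2.le.trans hTb.le)]

end IsSolutionOn

end Solutions

/-! ### Carathéodory's existence theorem -/

theorem aestronglyMeasurable_superposition {X Y : Type*} [TopologicalSpace X]
    [TopologicalSpace.PseudoMetrizableSpace X] [NormedAddCommGroup Y] {μ : Measure ℝ}
    {g : ℝ → X → Y} (hcont : ∀ t, Continuous (g t))
    (hmeas : ∀ x, AEStronglyMeasurable (fun t => g t x) μ) {x : ℝ → X} (hx : Continuous x) :
    AEStronglyMeasurable (fun t => g t (x t)) μ := by
  have hsm := hx.stronglyMeasurable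
  refine aestronglyMeasurable_of_tendsto_ae atTop (f := fun n t => g t (hsm.approx n t)) ?_
    (Eventually.of_forall fun t => ((hcont t).tendsto _).comp (hsm.tendsto_approx t))
  intro n
  set φ := hsm.approx n
  have hsum : (fun t => g t (φ t)) =
      fun t => ∑ y ∈ φ.range, (φ ⁻¹' {y}).indicator (fun t => g t y) t := by
    funext t
    rw [Finset.sum_eq_single_of_mem (φ t) (φ.mem_range_self t) fun y _ hy =>
      indicator_of_notMem (by simpa using hy.symm) _]
    simp
  rw [hsum]
  exact Finset.aestronglyMeasurable_fun_sum _ fun y _ =>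
    (hmeas y).indicator (φ.measurableSet_fiber y)

section Existence

variable {X : Type*} [NormedAddCommGroup X] [NormedSpace ℝ X]

theorem lipschitzWith_integral {k : ℝ → X} {C : NNReal} (hk : AEStronglyMeasurable k volume)
    (hC : ∀ t, ‖k t‖ ≤ C) (b : ℝ) (ξ : X) : LipschitzWith C (fun t => ξ + ∫ s in b..t, k s) := by
  have hint : ∀ p q : ℝ, IntervalIntegrable k volume p q := fun p q =>
    (intervalIntegrable_const (c := (C : ℝ))).mono_fun hk.restrict
      (Eventually.of_forall fun t => by simpa using hC t)
  refine LipschitzWith.of_dist_le_mul fun s t => ?_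
  rw [dist_add_left, dist_eq_norm,
    intervalIntegral.integral_interval_sub_left (hint _ _) (hint _ _), Real.dist_eq]
  exact intervalIntegral.norm_integral_le_of_norm_le_const fun r _ => hC r

theorem hasAEDerivOn_integral [CompleteSpace X] {k : ℝ → X} {C : NNReal}
    (hk : AEStronglyMeasurable k volume) (hC : ∀ t, ‖k t‖ ≤ C) (b : ℝ) (ξ : X) (p q : ℝ) :
    HasAEDerivOn (fun t => ξ + ∫ s in b..t, k s) k p q where
  absolutelyContinuous :=
    ((lipschitzWith_integral hk hC b ξ).lipschitzOnWith
      (s := uIcc p q)).absolutelyContinuousOnInterval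
  hasDerivAt := by
    have hint : LocallyIntegrable k volume := (locallyIntegrable_const (C : ℝ)).mono hk
      (Eventually.of_forall fun t => by simpa using hC t)
    filter_upwards [LocallyIntegrable.ae_hasDerivAt_integral hint] with t ht _
    exact (ht b).const_add ξ

/-- The radial retraction onto the closed ball `B(ξ, r)`. -/
def radialRetraction (ξ : X) (r : ℝ) (η : X) : X := ξ + (r / max r ‖η - ξ‖) • (η - ξ)

theorem continuous_radialRetraction (ξ : X) {r : ℝ} (hr : 0 < r) :
    Continuous (radialRetraction ξ r) := by
  unfold radialRetraction
  have hne : ∀ η : X, max r ‖η - ξ‖ ≠ 0 := fun η => (hr.trans_le (le_max_left _ _)).ne'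
  fun_prop (disch := assumption)

theorem radialRetraction_mem (ξ : X) {r : ℝ} (hr : 0 < r) (η : X) :
    radialRetraction ξ r η ∈ Metric.closedBall ξ r := by
  have hmax : 0 < max r ‖η - ξ‖ := hr.trans_le (le_max_left _ _)
  rw [mem_closedBall_iff_norm, radialRetraction, add_sub_cancel_left, norm_smul, Real.norm_eq_abs,
    abs_of_pos (by positivity), div_mul_eq_mul_div, div_le_iff₀ hmax]
  exact mul_le_mul_of_nonneg_left (le_max_right _ _) hr.le

theorem radialRetraction_of_mem {ξ : X} {r : ℝ} (hr : 0 < r) {η : X}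
    (h : η ∈ Metric.closedBall ξ r) : radialRetraction ξ r η = η := by
  rw [mem_closedBall_iff_norm] at h
  rw [radialRetraction, max_eq_left h, div_self hr.ne', one_smul, add_sub_cancel]

/-- The integral operator of the delayed equation `x'(t) = g(t, x(t - h))`, `t ≥ b`, with history
`x(t) = ξ`, `t ≤ b`. Iterating it `n` times solves the delayed equation on `[b, b + n h]`, which
yields approximate solutions of `x' = g(t, x)` without any Lipschitz condition. -/
def delayedPicard (g : ℝ → X → X) (b : ℝ) (ξ : X) (h : ℝ) (x : ℝ → X) (t : ℝ) : X :=
  ξ + ∫ s in b..max t b, g s (x (s - h))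

theorem eqOn_delayedPicard (g : ℝ → X → X) {b : ℝ} (ξ : X) {h T : ℝ} (hT : b ≤ T + h)
    {x y : ℝ → X} (hxy : EqOn x y (Iic T)) :
    EqOn (delayedPicard g b ξ h x) (delayedPicard g b ξ h y) (Iic (T + h)) := by
  intro t ht
  refine congrArg (ξ + ·) (intervalIntegral.integral_congr fun s hs => ?_)
  rw [uIcc_of_le (le_max_right _ _)] at hs
  have hsT : s ≤ T + h := hs.2.trans (max_le ht hT)
  exact congrArg (g s) (hxy (sub_le_iff_le_add.2 hsT))

theorem eqOn_iterate_delayedPicard (g : ℝ → X → X) (b : ℝ) (ξ : X) {h : ℝ} (hh : 0 ≤ h) (n : ℕ) :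
    EqOn ((delayedPicard g b ξ h)^[n + 1] fun _ => ξ) ((delayedPicard g b ξ h)^[n] fun _ => ξ)
      (Iic (b + n * h)) := by
  induction n with
  | zero =>
    intro t ht
    have htb : t ≤ b := by simpa using ht
    simp [delayedPicard, max_eq_right htb]
  | succ n ih =>
    rw [Function.iterate_succ_apply', Function.iterate_succ_apply',
      show b + (n + 1 : ℕ) * h = b + n * h + h by push_cast; ring]
    rw [Function.iterate_succ_apply'] at ih
    exact eqOn_delayedPicard g ξ (by nlinarith [n.cast_nonneg (α := ℝ)]) ih

variable {g : ℝ → X → X} {C : NNReal}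

theorem lipschitzWith_delayedPicard (hC : ∀ t x, ‖g t x‖ ≤ C) (hcont : ∀ t, Continuous (g t))
    (hmeas : ∀ x, AEStronglyMeasurable (fun t => g t x) volume) (b : ℝ) (ξ : X) (h : ℝ)
    {x : ℝ → X} (hx : Continuous x) : LipschitzWith C (delayedPicard g b ξ h x) := by
  have hdelayed : AEStronglyMeasurable (fun s => g s (x (s - h))) volume :=
    aestronglyMeasurable_superposition hcont hmeas (hx.comp (continuous_id.sub continuous_const))
  have hcomp := (lipschitzWith_integral hdelayed (fun s => hC s _) b ξ).comp
    (LipschitzWith.id.max_const b)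
  rwa [mul_one] at hcomp

theorem exists_delayed_solution (hC : ∀ t x, ‖g t x‖ ≤ C) (hcont : ∀ t, Continuous (g t))
    (hmeas : ∀ x, AEStronglyMeasurable (fun t => g t x) volume) {b c : ℝ} (hbc : b ≤ c) (ξ : X)
    (k : ℕ) : ∃ u : ℝ → X, LipschitzWith C u ∧
      ∀ t ∈ Icc b c, u t = ξ + ∫ s in b..t, g s (u (s - (c - b) / (k + 1))) := by
  set h : ℝ := (c - b) / (k + 1) with hh
  have hnonneg : 0 ≤ h := div_nonneg (sub_nonneg.2 hbc) (by positivity)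
  set u : ℕ → ℝ → X := fun n => (delayedPicard g b ξ h)^[n] fun _ => ξ
  have hsucc : ∀ n, u (n + 1) = delayedPicard g b ξ h (u n) := fun n =>
    Function.iterate_succ_apply' _ _ _
  have hLip : ∀ n, LipschitzWith C (u n) := by
    intro n
    induction n with
    | zero => exact (LipschitzWith.const ξ).weaken zero_le
    | succ n ih => exact hsucc n ▸ lipschitzWith_delayedPicard hC hcont hmeas b ξ h ih.continuous
  have hc : c = b + (k + 1 : ℕ) * h := by
    rw [hh]; push_cast; field_simp; ring
  refine ⟨u (k + 1), hLip _, fun t ht => ?_⟩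
  have hstable : u (k + 1 + 1) t = u (k + 1) t :=
    eqOn_iterate_delayedPicard g b ξ hnonneg (k + 1) (hc ▸ ht.2 : t ∈ Iic _)
  rw [← hstable, hsucc, delayedPicard, max_eq_left ht.1]

theorem exists_subseq_tendsto_of_lipschitzWith {X : Type*} [MetricSpace X] [ProperSpace X]
    {C : NNReal} {u : ℕ → ℝ → X} (hLip : ∀ k, LipschitzWith C (u k)) {b c : ℝ} (hbc : b ≤ c)
    {ξ : X} (hub : ∀ k, u k b = ξ) : ∃ (x : ℝ → X) (φ : ℕ → ℕ), Continuous x ∧ StrictMono φ ∧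
      ∀ t ∈ Icc b c, Tendsto (fun k => u (φ k) t) atTop (𝓝 (x t)) := by
  let U : ℕ → BoundedContinuousFunction (Icc b c) X := fun k =>
    BoundedContinuousFunction.mkOfCompact
      ⟨fun t => u k t, (hLip k).continuous.comp continuous_subtype_val⟩
  have hcompact : IsCompact (closure (range U)) := by
    refine BoundedContinuousFunction.arzela_ascoli (Metric.closedBall ξ (C * (c - b)))
      (isCompact_closedBall _ _) _ ?_ ?_
    · rintro _ ⟨t, ht⟩ ⟨k, rfl⟩
      refine Metric.mem_closedBall.2 ((hub k ▸ (hLip k).dist_le_mul t b).trans ?_)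
      rw [Real.dist_eq, abs_of_nonneg (sub_nonneg.2 ht.1)]
      exact mul_le_mul_of_nonneg_left (sub_le_sub_right ht.2 b) C.2
    · refine LipschitzWith.uniformEquicontinuous _ C ?_ |>.equicontinuous
      rintro ⟨_, k, rfl⟩
      exact (hLip k).comp (LipschitzWith.subtype_val _) |>.weaken (by simp)
  obtain ⟨v, -, φ, hφ, hv⟩ := hcompact.tendsto_subseq
    (fun k => subset_closure (mem_range_self (f := U) k))
  refine ⟨IccExtend hbc v, φ, v.continuous.Icc_extend', hφ, fun t ht => ?_⟩
  rw [IccExtend_of_mem hbc _ ht]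
  exact ((BoundedContinuousFunction.lipschitz_eval_const ⟨t, ht⟩).continuous.tendsto v).comp hv

variable [FiniteDimensional ℝ X]

theorem exists_integral_solution (hC : ∀ t x, ‖g t x‖ ≤ C) (hcont : ∀ t, Continuous (g t))
    (hmeas : ∀ x, AEStronglyMeasurable (fun t => g t x) volume) {b c : ℝ} (hbc : b ≤ c) (ξ : X) :
    ∃ x : ℝ → X, Continuous x ∧ ∀ t ∈ Icc b c, x t = ξ + ∫ s in b..t, g s (x s) := by
  have := FiniteDimensional.proper_real X
  choose u hLip hu using exists_delayed_solution hC hcont hmeas hbc ξ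
  obtain ⟨x, φ, hx, hφ, hlim⟩ := exists_subseq_tendsto_of_lipschitzWith hLip hbc
    fun k => by simpa using hu k b (left_mem_Icc.2 hbc)
  set h : ℕ → ℝ := fun k => (c - b) / (φ k + 1) with hh
  have hh_lim : Tendsto (fun k => (C : ℝ) * |h k|) atTop (𝓝 0) := by
    have := ((tendsto_one_div_add_atTop_nhds_zero_nat (𝕜 := ℝ)).comp
      hφ.tendsto_atTop).const_mul (c - b)
    simpa [hh, div_eq_mul_inv] using this.abs.const_mul (C : ℝ)
  have hlim_delayed : ∀ t ∈ Icc b c, Tendsto (fun k => u (φ k) (t - h k)) atTop (𝓝 (x t)) := by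
    refine fun t ht => tendsto_of_tendsto_of_dist (hlim t ht) ?_
    refine squeeze_zero (fun _ => dist_nonneg) (fun k => ?_) hh_lim
    simpa [Real.dist_eq] using (hLip (φ k)).dist_le_mul t (t - h k)
  refine ⟨x, hx, fun t ht => tendsto_nhds_unique (hlim t ht) ?_⟩
  simp only [fun k => hu (φ k) t ht]
  refine tendsto_const_nhds.add ?_
  refine intervalIntegral.tendsto_integral_filter_of_dominated_convergence (fun _ => (C : ℝ))
    (Eventually.of_forall fun k => ?_) (Eventually.of_forall fun k => Eventually.of_forall
      fun s _ => hC _ _) intervalIntegrable_const (Eventually.of_forall fun s hs => ?_)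
  · exact (aestronglyMeasurable_superposition hcont hmeas
      ((hLip (φ k)).continuous.comp (continuous_id.sub continuous_const))).restrict
  · rw [uIoc_of_le ht.1] at hs
    exact ((hcont s).tendsto _).comp (hlim_delayed s ⟨hs.1.le, hs.2.trans ht.2⟩)

theorem exists_bounded_extension {X Y : Type*} [NormedAddCommGroup X] [NormedSpace ℝ X]
    [NormedAddCommGroup Y] {f : ℝ → X → Y} {C : ℝ} {b c r : ℝ} {ξ : X} (hbc : b ≤ c) (hr : 0 < r)
    (hC : ∀ t ∈ Icc b c, ∀ η ∈ Metric.closedBall ξ r, ‖f t η‖ ≤ C)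
    (hcont : ∀ t ∈ Icc b c, ContinuousOn (f t) (Metric.closedBall ξ r))
    (hmeas : ∀ η ∈ Metric.closedBall ξ r,
      AEStronglyMeasurable (fun t => f t η) (volume.restrict (Icc b c))) :
    ∃ g : ℝ → X → Y, (∀ t η, ‖g t η‖ ≤ C) ∧ (∀ t, Continuous (g t)) ∧
      (∀ η, AEStronglyMeasurable (fun t => g t η) volume) ∧
      ∀ t ∈ Icc b c, ∀ η ∈ Metric.closedBall ξ r, g t η = f t η := by
  have hC0 : 0 ≤ C := (norm_nonneg _).trans
    (hC b (left_mem_Icc.2 hbc) ξ (Metric.mem_closedBall_self hr.le))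
  let g : ℝ → X → Y := fun t η => (Icc b c).indicator (fun t => f t (radialRetraction ξ r η)) t
  have hin : ∀ t ∈ Icc b c, g t = fun η => f t (radialRetraction ξ r η) := fun t ht =>
    funext fun η => indicator_of_mem ht _
  have hout : ∀ t ∉ Icc b c, g t = fun _ => 0 := fun t ht =>
    funext fun η => indicator_of_notMem ht _
  refine ⟨g, fun t η => ?_, fun t => ?_, fun η => ?_, fun t ht η hη => ?_⟩
  · by_cases ht : t ∈ Icc b c
    · simpa only [hin t ht] using hC t ht _ (radialRetraction_mem ξ hr η)
    · simpa only [hout t ht, norm_zero] using hC0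
  · by_cases ht : t ∈ Icc b c
    · exact hin t ht ▸ (hcont t ht).comp_continuous (continuous_radialRetraction ξ hr)
        (radialRetraction_mem ξ hr)
    · exact hout t ht ▸ continuous_const
  · exact (aestronglyMeasurable_indicator_iff measurableSet_Icc).2
      (hmeas _ (radialRetraction_mem ξ hr η))
  · simp only [hin t ht, radialRetraction_of_mem hr hη]

theorem exists_local_solution {f : ℝ → X → X} {D : Set (ℝ × X)} {b c r C : ℝ} {ξ : X}
    (hbc : b < c) (hr : 0 < r)
    (hD : ∀ t ∈ Icc b c, ∀ η ∈ Metric.closedBall ξ r, (t, η) ∈ D)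
    (hC : ∀ t ∈ Icc b c, ∀ η ∈ Metric.closedBall ξ r, ‖f t η‖ ≤ C)
    (hcont : ∀ t ∈ Icc b c, ContinuousOn (f t) (Metric.closedBall ξ r))
    (hmeas : ∀ η ∈ Metric.closedBall ξ r,
      AEStronglyMeasurable (fun t => f t η) (volume.restrict (Icc b c))) :
    ∃ (T : ℝ) (x : ℝ → X), b < T ∧ x b = ξ ∧ IsSolutionOn f D b T x := by
  have := FiniteDimensional.complete ℝ X
  obtain ⟨g, hgC, hgcont, hgmeas, hgf⟩ := exists_bounded_extension hbc.le hr hC hcont hmeas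
  lift C to NNReal using (norm_nonneg _).trans (hgC b ξ)
  obtain ⟨x, hx, hxint⟩ := exists_integral_solution hgC hgcont hgmeas hbc.le ξ
  have hxb : x b = ξ := by simpa using hxint b (left_mem_Icc.2 hbc.le)
  have hnear : x ⁻¹' Metric.closedBall ξ r ∈ 𝓝[≥] b := mem_nhdsWithin_of_mem_nhds
    (hx.continuousAt.preimage_mem_nhds (hxb.symm ▸ Metric.closedBall_mem_nhds ξ hr))
  obtain ⟨T, hbT, hball⟩ := (mem_nhdsGE_iff_exists_mem_Ioc_Ico_subset hbc).1 hnear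
  refine ⟨T, x, hbT.1, hxb, isSolutionOn_iff.2 fun t hbt htT => ?_⟩
  rw [EReal.coe_lt_coe_iff] at htT
  have hmem : ∀ s ∈ Icc b t, s ∈ Icc b c ∧ x s ∈ Metric.closedBall ξ r := fun s hs =>
    ⟨⟨hs.1, (hs.2.trans htT.le).trans hbT.2⟩, hball ⟨hs.1, hs.2.trans_lt htT⟩⟩
  have ht := hmem t (right_mem_Icc.2 hbt)
  have hsm := aestronglyMeasurable_superposition hgcont hgmeas hx
  refine ⟨hD t ht.1 _ ht.2, ((hasAEDerivOn_integral hsm (fun s => hgC s _) b ξ b t).congr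
    fun s hs => hxint s (hmem s ((uIcc_of_le hbt).subset hs)).1).congr_deriv fun s hs => ?_⟩
  have hs' := hmem s (Ioo_subset_Icc_self hs)
  exact hgf s hs'.1 _ hs'.2

end Existence

/-! ### Maximal solutions -/

section Maximal

/-- The order of extension among functions `p.2` on intervals `[a, p.1)`. -/
def IsExtension {X : Type*} (a : ℝ) (p q : EReal × (ℝ → X)) : Prop :=
  p.1 ≤ q.1 ∧ ∀ t : ℝ, a ≤ t → (t : EReal) < p.1 → q.2 t = p.2 t

theorem IsExtension.trans {X : Type*} {a : ℝ} {p q r : EReal × (ℝ → X)} (hpq : IsExtension a p q)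
    (hqr : IsExtension a q r) : IsExtension a p r :=
  ⟨hpq.1.trans hqr.1, fun t hat htp =>
    (hqr.2 t hat (htp.trans_le hpq.1)).trans (hpq.2 t hat htp)⟩

variable {X : Type*} [NormedAddCommGroup X] [NormedSpace ℝ X] {f : ℝ → X → X} {D : Set (ℝ × X)}
  {a : ℝ} {ω : EReal}

theorem exists_isSolutionOn_of_isChain {c : Set (EReal × (ℝ → X))} (hc : IsChain (IsExtension a) c)
    (hsol : ∀ p ∈ c, IsSolutionOn f D a p.1 p.2) :
    ∃ (ω : EReal) (x : ℝ → X), IsSolutionOn f D a ω x ∧ ∀ p ∈ c, IsExtension a p (ω, x) := by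
  have hunion : ∀ t : ℝ, ∃ v : X, a ≤ t → ∀ p ∈ c, (t : EReal) < p.1 → v = p.2 t := by
    intro t
    by_cases h : ∃ p ∈ c, (t : EReal) < p.1
    · obtain ⟨p, hp, htp⟩ := h
      refine ⟨p.2 t, fun hat q hq htq => ?_⟩
      rcases eq_or_ne p q with rfl | hpq
      · rfl
      rcases hc hp hq hpq with h | h
      · exact (h.2 t hat htp).symm
      · exact h.2 t hat htq
    · exact ⟨0, fun _ p hp htp => (h ⟨p, hp, htp⟩).elim⟩
  choose x hx using hunion
  have hext : ∀ p ∈ c, IsExtension a p (sSup (Prod.fst '' c), x) := fun p hp =>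
    ⟨le_sSup (mem_image_of_mem _ hp), fun t hat htp => hx t hat p hp htp⟩
  refine ⟨_, x, isSolutionOn_iff.2 fun T haT hT => ?_, hext⟩
  obtain ⟨_, ⟨p, hp, rfl⟩, hTp⟩ := lt_sSup_iff.1 hT
  exact isSolutionOn_iff.1 ((hsol p hp).congr (hext p hp).2) T haT hTp

theorem IsSolutionOn.exists_isMaximalSolution {x₀ : ℝ → X} {ω₀ : EReal}
    (h₀ : IsSolutionOn f D a ω₀ x₀) (hlt : (a : EReal) < ω₀) :
    ∃ (ω : EReal) (x : ℝ → X), x a = x₀ a ∧ IsMaximalSolution f D a ω x := by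
  let P := {p : EReal × (ℝ → X) // IsSolutionOn f D a p.1 p.2 ∧ IsExtension a (ω₀, x₀) p}
  obtain ⟨⟨⟨ω, x⟩, hsol, hext⟩, hmax⟩ : ∃ m : P, ∀ p : P, IsExtension a m.1 p.1 →
      IsExtension a p.1 m.1 := by
    refine exists_maximal_of_chains_bounded (fun c hc => ?_) fun hpq hqr => hpq.trans hqr
    rcases c.eq_empty_or_nonempty with rfl | ⟨p₀, hp₀⟩
    · exact ⟨⟨(ω₀, x₀), h₀, le_rfl, fun _ _ _ => rfl⟩, fun p hp => hp.elim⟩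
    obtain ⟨ω, x, hx, hub⟩ := exists_isSolutionOn_of_isChain (f := f) (D := D)
      (IsChain.image_of_map_rel _ (IsExtension a) Subtype.val (fun _ _ h => h) hc)
      (by rintro _ ⟨p, -, rfl⟩; exact p.2.1)
    exact ⟨⟨(ω, x), hx, p₀.2.2.trans (hub _ (mem_image_of_mem _ hp₀))⟩,
      fun p hp => hub _ (mem_image_of_mem _ hp)⟩
  refine ⟨ω, x, hext.2 a le_rfl hlt, hlt.trans_le hext.1, hsol, fun ω' x' hx' heq => ?_⟩
  by_contra! hlt'
  have hext' : IsExtension a (ω, x) (ω', x') := ⟨hlt'.le, heq⟩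
  exact hlt'.not_ge (hmax ⟨(ω', x'), hx', hext.trans hext'⟩ hext').1

theorem IsMaximalSolution.not_exists_continuation {x : ℝ → X} {s b : ℝ} {M : NNReal} {ξ : X}
    (hx : IsMaximalSolution f D a b x) (hs : s ∈ Ico a b) (hM : ∀ t ∈ Ico s b, ‖f t (x t)‖ ≤ M)
    (hξ : Tendsto x (𝓝[<] b) (𝓝 ξ)) {c : ℝ} {y : ℝ → X} (hbc : b < c) (hyb : y b = ξ)
    (hy : IsSolutionOn f D b c y) : False := by
  have hab : a ≤ b := hs.1.trans hs.2.le
  set x' : ℝ → X := Function.update x b ξ with hx'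
  have hx'_of_lt : ∀ t < b, x' t = x t := fun t ht => Function.update_of_ne ht.ne _ _
  have hx'b : x' b = y b := by rw [hyb, hx', Function.update_self]
  have hsol := isSolutionOn_iff.1 hx.isSolutionOn
  have hac : HasAEDerivOn x' (fun t => f t (x' t)) a b :=
    (HasAEDerivOn.update_of_tendsto (fun T hT => (hsol T hT.1 (EReal.coe_lt_coe_iff.2 hT.2)).2)
      hs hM hξ).congr_deriv fun t ht => by simp only [hx'_of_lt t ht.2]
  have hD : ∀ t ∈ Icc a b, (t, x' t) ∈ D := by
    intro t ht
    rcases ht.2.eq_or_lt with rfl | htb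
    · rw [hx'b]
      exact hy.mem_domain t le_rfl (EReal.coe_lt_coe_iff.2 hbc)
    · rw [hx'_of_lt t htb]
      exact (hsol t ht.1 (EReal.coe_lt_coe_iff.2 htb)).1
  have hle := hx.maximal _ _ (IsSolutionOn.piecewise hab hD hac hy hx'b) fun t _ htb => by
    rw [EReal.coe_lt_coe_iff] at htb
    rw [piecewise_Iic_of_le htb.le, hx'_of_lt t htb]
  exact hbc.not_ge (EReal.coe_le_coe_iff.1 hle)

end Maximal

/-! ### Comparison functions -/

theorem ClassK.monotoneOn {α : ℝ → ℝ} (h : ClassK α) : MonotoneOn α (Ici 0) :=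
  h.strictMonoOn.monotoneOn

theorem ClassK.nonneg {α : ℝ → ℝ} (h : ClassK α) {r : ℝ} (hr : 0 ≤ r) : 0 ≤ α r :=
  h.zero ▸ h.monotoneOn self_mem_Ici hr hr

theorem ClassKL.nonneg {β : ℝ → ℝ → ℝ} (h : ClassKL β) {r t : ℝ} (hr : 0 ≤ r) (ht : 0 ≤ t) :
    0 ≤ β r t :=
  (h.classK t ht).nonneg hr

/-- The average of `ρ` over `[v, 2 v]`: for a monotone `ρ` it is a majorant which is continuous, as
the discontinuities of `ρ` form a null set. -/
def dilationAverage (ρ : ℝ → ℝ) (v : ℝ) : ℝ := ∫ s in (1 : ℝ)..2, ρ (v * s)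

section DilationAverage

variable {ρ : ℝ → ℝ}

theorem intervalIntegrable_dilation (hρ : Monotone ρ) {v : ℝ} (hv : 0 ≤ v) (a b : ℝ) :
    IntervalIntegrable (fun s => ρ (v * s)) volume a b :=
  (hρ.comp (monotone_id.const_mul hv)).intervalIntegrable

theorem le_dilationAverage (hρ : Monotone ρ) {v : ℝ} (hv : 0 ≤ v) : ρ v ≤ dilationAverage ρ v := by
  calc ρ v = ∫ _ in (1 : ℝ)..2, ρ v := by norm_num
    _ ≤ dilationAverage ρ v :=
      intervalIntegral.integral_mono_on one_le_two intervalIntegrable_const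
        (intervalIntegrable_dilation hρ hv 1 2) fun s hs => hρ (le_mul_of_one_le_right hv hs.1)

theorem monotoneOn_dilationAverage (hρ : Monotone ρ) : MonotoneOn (dilationAverage ρ) (Ici 0) :=
  fun _ hv _ hv' hvv' => intervalIntegral.integral_mono_on one_le_two
    (intervalIntegrable_dilation hρ hv 1 2) (intervalIntegrable_dilation hρ hv' 1 2) fun _ hs =>
      hρ (mul_le_mul_of_nonneg_right hvv' (zero_le_one.trans hs.1))

theorem ae_continuousAt_dilation (hρ : Monotone ρ) (hρ₀ : ContinuousAt ρ 0) {v : ℝ} (hv : 0 ≤ v) :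
    ∀ᵐ s : ℝ, ContinuousAt ρ (v * s) := by
  rcases hv.eq_or_lt with rfl | hv
  · exact Eventually.of_forall fun s => by rwa [zero_mul]
  · have hcountable : {s : ℝ | ¬ContinuousAt ρ (v * s)}.Countable :=
      hρ.countable_not_continuousAt.preimage_of_injOn (mul_right_injective₀ hv.ne').injOn
    filter_upwards [hcountable.ae_notMem volume] with s hs
    exact not_not.1 hs

theorem continuousOn_dilationAverage (hρ : Monotone ρ) (hρ₀ : ContinuousAt ρ 0) :
    ContinuousOn (dilationAverage ρ) (Ici 0) := by
  intro v hv
  rw [mem_Ici] at hv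
  set R : ℝ := 2 * (v + 1)
  refine (intervalIntegral.continuousAt_of_dominated_interval
    (bound := fun _ => max |ρ (-R)| |ρ R|) (Eventually.of_forall fun u =>
      (hρ.measurable.comp (measurable_const_mul u)).aestronglyMeasurable)
    ?_ intervalIntegrable_const ?_).continuousWithinAt
  · filter_upwards [Ioo_mem_nhds (by linarith : -1 < v) (lt_add_one v)] with u hu
    refine Eventually.of_forall fun s hs => ?_
    rw [uIoc_of_le one_le_two] at hs
    have hus : |u * s| ≤ R := by
      rw [abs_mul, abs_of_pos (zero_lt_one.trans hs.1), mul_comm]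
      have hu' : |u| ≤ v + 1 := abs_le.2 ⟨by linarith [hu.1], hu.2.le⟩
      exact mul_le_mul hs.2 hu' (abs_nonneg u) zero_le_two
    exact abs_le_max_abs_abs (hρ (abs_le.1 hus).1) (hρ (abs_le.1 hus).2)
  · filter_upwards [ae_continuousAt_dilation hρ hρ₀ hv] with s hs _
    exact hs.comp (f := fun u : ℝ => u * s) (by fun_prop)

theorem exists_classKInfty_majorant (hρ : Monotone ρ) (hρ₀ : ContinuousAt ρ 0) (h0 : ρ 0 = 0) :
    ∃ γ, ClassKInfty γ ∧ ∀ v, 0 ≤ v → ρ v ≤ γ v := by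
  have hle : ∀ v, 0 ≤ v → v ≤ v + dilationAverage ρ v := fun v hv =>
    le_add_of_nonneg_right ((h0 ▸ hρ hv).trans (le_dilationAverage hρ hv))
  refine ⟨fun v => v + dilationAverage ρ v, ⟨⟨?_, ?_, ?_⟩, ?_⟩, fun v hv => ?_⟩
  · exact continuousOn_id.add (continuousOn_dilationAverage hρ hρ₀)
  · exact fun v hv v' hv' hvv' =>
      add_lt_add_of_lt_of_le hvv' (monotoneOn_dilationAverage hρ hv hv' hvv'.le)
  · simp [dilationAverage, h0]
  · exact tendsto_atTop_mono' atTop ((eventually_ge_atTop 0).mono hle) tendsto_id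
  · exact (le_dilationAverage hρ hv).trans (le_add_of_nonneg_left hv)

end DilationAverage

/-- The gain `v ↦ inf_{h ≥ 0} (b(h) + γ(v / w(h)))` resulting from observing a system over windows
of arbitrary length `h`, with residue `b(h)` of the initial value and weight `w`. Negative arguments
are cut off, so that it is monotone on the whole line. -/
def fadingGain (b γ w : ℝ → ℝ) (v : ℝ) : ℝ := ⨅ h : Ici (0 : ℝ), b h + γ (max v 0 / w h)

section FadingGain

variable {b γ w : ℝ → ℝ}

theorem fadingGain_term_nonneg (hb : ∀ h, 0 ≤ h → 0 ≤ b h) (hγ : ClassK γ)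
    (hw : ∀ h, 0 ≤ h → 0 < w h) (v : ℝ) (h : Ici (0 : ℝ)) : 0 ≤ b h + γ (max v 0 / w h) :=
  add_nonneg (hb h h.2) (hγ.nonneg (div_nonneg (le_max_right _ _) (hw h h.2).le))

theorem fadingGain_nonneg (hb : ∀ h, 0 ≤ h → 0 ≤ b h) (hγ : ClassK γ)
    (hw : ∀ h, 0 ≤ h → 0 < w h) (v : ℝ) : 0 ≤ fadingGain b γ w v :=
  le_ciInf (fadingGain_term_nonneg hb hγ hw v)

theorem fadingGain_le (hb : ∀ h, 0 ≤ h → 0 ≤ b h) (hγ : ClassK γ) (hw : ∀ h, 0 ≤ h → 0 < w h)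
    (v : ℝ) {h : ℝ} (hh : 0 ≤ h) : fadingGain b γ w v ≤ b h + γ (max v 0 / w h) :=
  ciInf_le ⟨0, forall_mem_range.2 (fadingGain_term_nonneg hb hγ hw v)⟩ (⟨h, hh⟩ : Ici (0 : ℝ))

theorem monotone_fadingGain (hb : ∀ h, 0 ≤ h → 0 ≤ b h) (hγ : ClassK γ)
    (hw : ∀ h, 0 ≤ h → 0 < w h) : Monotone (fadingGain b γ w) := fun v v' hvv' =>
  ciInf_mono ⟨0, forall_mem_range.2 (fadingGain_term_nonneg hb hγ hw v)⟩ fun h => by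
    have hw' := (hw h h.2).le
    exact add_le_add_right (hγ.monotoneOn (div_nonneg (le_max_right _ _) hw')
      (div_nonneg (le_max_right _ _) hw') (by gcongr)) _

theorem tendsto_fadingGain_zero (hb : ∀ h, 0 ≤ h → 0 ≤ b h) (hb_lim : Tendsto b atTop (𝓝 0))
    (hγ : ClassK γ) (hw : ∀ h, 0 ≤ h → 0 < w h) : Tendsto (fadingGain b γ w) (𝓝 0) (𝓝 0) := by
  refine tendsto_order.2 ⟨fun a ha => Eventually.of_forall fun v =>
    ha.trans_le (fadingGain_nonneg hb hγ hw v), fun ε hε => ?_⟩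
  obtain ⟨h, hh, hbh⟩ :=
    ((eventually_ge_atTop 0).and (hb_lim.eventually (gt_mem_nhds hε))).exists
  have harg : Tendsto (fun v : ℝ => max v 0 / w h) (𝓝 0) (𝓝[≥] 0) := by
    refine tendsto_nhdsWithin_iff.2 ⟨?_, Eventually.of_forall fun v =>
      div_nonneg (le_max_right v 0) (hw h hh).le⟩
    exact Continuous.tendsto' (by fun_prop) _ _ (by simp)
  have hγ₀ : Tendsto γ (𝓝[≥] 0) (𝓝 0) := by
    simpa only [ContinuousWithinAt, hγ.zero] using hγ.continuousOn 0 self_mem_Ici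
  have hterm : Tendsto (fun v => b h + γ (max v 0 / w h)) (𝓝 0) (𝓝 (b h)) := by
    simpa only [add_zero, Function.comp_apply] using (hγ₀.comp harg).const_add (b h)
  filter_upwards [hterm.eventually (gt_mem_nhds hbh)] with v hv
  exact (fadingGain_le hb hγ hw v hh).trans_lt hv

theorem exists_classKInfty_fadingGain_le (hb : ∀ h, 0 ≤ h → 0 ≤ b h)
    (hb_lim : Tendsto b atTop (𝓝 0)) (hγ : ClassK γ) (hw : ∀ h, 0 ≤ h → 0 < w h) :
    ∃ γ', ClassKInfty γ' ∧ ∀ v, 0 ≤ v → fadingGain b γ w v ≤ γ' v := by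
  have hlim := tendsto_fadingGain_zero hb hb_lim hγ hw
  have h0 : fadingGain b γ w 0 = 0 :=
    le_antisymm (le_of_forall_gt_imp_ge_of_dense fun ε hε =>
      (hlim.eventually (gt_mem_nhds hε)).self_of_nhds.le) (fadingGain_nonneg hb hγ hw 0)
  exact exists_classKInfty_majorant (monotone_fadingGain hb hγ hw)
    (by rwa [ContinuousAt, h0]) h0

end FadingGain

/-! ### Consequences of incremental input-to-state stability -/

section DeltaISS

variable {X U : Type*} [NormedAddCommGroup X] [NormedSpace ℝ X] [NormedAddCommGroup U]

theorem IsAdmissibleInput.mono {τ τ' : ℝ} {u : ℝ → U} (h : IsAdmissibleInput τ u)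
    (hτ : τ ≤ τ') : IsAdmissibleInput τ' u where
  measurable := h.measurable.mono_measure (Measure.restrict_mono (Ici_subset_Ici.2 hτ) le_rfl)
  locallyBounded T := (h.locallyBounded T).imp fun _ hC =>
    ae_mono (Measure.restrict_mono (Icc_subset_Icc_left hτ) le_rfl) hC

theorem isAdmissibleInput_zero (τ : ℝ) : IsAdmissibleInput τ (fun _ => (0 : U)) where
  measurable := aestronglyMeasurable_const
  locallyBounded _ := ⟨0, by simp⟩

namespace IsDeltaISS

variable {t₀ : ℝ} {f : ℝ → X → U → X} {β : ℝ → ℝ → ℝ} {γ : ℝ → ℝ} {τ : ℝ} {u u' : ℝ → U}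
  {x x' : ℝ → X}

theorem norm_sub_le (h : IsDeltaISS t₀ f β γ) (hτ : t₀ ≤ τ) (hu : IsAdmissibleInput τ u)
    (hu' : IsAdmissibleInput τ u') (hx : IsSolutionOn (fun t ξ => f t ξ (u t)) univ τ ⊤ x)
    (hx' : IsSolutionOn (fun t ξ => f t ξ (u' t)) univ τ ⊤ x') {t R : ℝ} (hτt : τ ≤ t)
    (hR : 0 ≤ R) (hle : ∀ s ∈ Ico τ t, ‖u' s - u s‖ ≤ R) :
    ‖x' t - x t‖ ≤ β ‖x' τ - x τ‖ (t - τ) + γ R := by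
  have hsup : ⨆ s : Ico τ t, ‖u' s - u s‖ ≤ R := Real.iSup_le (fun s => hle s s.2) hR
  have hsup_nonneg : 0 ≤ ⨆ s : Ico τ t, ‖u' s - u s‖ := Real.iSup_nonneg fun _ => norm_nonneg _
  refine (h.estimate τ hτ u u' hu hu' x x' hx hx' t hτt ⟨R, forall_mem_image.2 hle⟩).trans ?_
  exact add_le_add_right (h.classKInfty.monotoneOn hsup_nonneg hR hsup) _

theorem norm_sub_le_of_eq (h : IsDeltaISS t₀ f β γ) (hτ : t₀ ≤ τ) (hu : IsAdmissibleInput τ u)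
    (hu' : IsAdmissibleInput τ u') (hx : IsSolutionOn (fun t ξ => f t ξ (u t)) univ τ ⊤ x)
    (hx' : IsSolutionOn (fun t ξ => f t ξ (u' t)) univ τ ⊤ x') (heq : x' τ = x τ) {t R : ℝ}
    (hτt : τ ≤ t) (hR : 0 ≤ R) (hle : ∀ s ∈ Ico τ t, ‖u' s - u s‖ ≤ R) :
    ‖x' t - x t‖ ≤ γ R := by
  simpa only [heq, sub_self, norm_zero, (h.classKL.classK _ (sub_nonneg.2 hτt)).zero, zero_add]
    using h.norm_sub_le hτ hu hu' hx hx' hτt hR hle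

theorem eq_of_isSolutionOn (h : IsDeltaISS t₀ f β γ) (hτ : t₀ ≤ τ) (hu : IsAdmissibleInput τ u)
    {ω : EReal} (hx : IsSolutionOn (fun t ξ => f t ξ (u t)) univ τ ω x)
    (hx' : IsSolutionOn (fun t ξ => f t ξ (u t)) univ τ ⊤ x') (heq : x' τ = x τ) {T : ℝ}
    (hT : τ ≤ T) (hTω : (T : EReal) < ω) : x' T = x T := by
  obtain ⟨y, hyT, hy⟩ := h.global T (hτ.trans hT) (x T) u (hu.mono hT)
  have hglued := IsSolutionOn.piecewise hT (fun _ _ => mem_univ _) (hx.hasAEDerivOn hT hTω) hy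
    hyT.symm
  have hle := h.norm_sub_le_of_eq hτ hu hu hglued hx'
    (by rw [piecewise_Iic_of_le hT, heq]) hT le_rfl (by simp)
  rw [piecewise_Iic_of_le le_rfl, h.classKInfty.zero] at hle
  exact sub_eq_zero.1 (norm_le_zero_iff.1 hle)

theorem norm_sub_le_fadingGain (h : IsDeltaISS t₀ f β γ) {w : ℝ → ℝ}
    (hw_anti : AntitoneOn w (Ici 0)) (hw : ∀ r, 0 ≤ r → 0 < w r)
    (hu : IsAdmissibleInput t₀ u) (hu' : IsAdmissibleInput t₀ u')
    (hx : IsSolutionOn (fun t ξ => f t ξ (u t)) univ t₀ ⊤ x)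
    (hx' : IsSolutionOn (fun t ξ => f t ξ (u' t)) univ t₀ ⊤ x') (heq : x' t₀ = x t₀) {C : ℝ}
    (hC : 0 ≤ C) {t v : ℝ} (ht : t₀ ≤ t) (hle_C : ∀ s ∈ Ico t₀ t, ‖u' s - u s‖ ≤ C) (hv : 0 ≤ v)
    (hle_v : ∀ s ∈ Ico t₀ t, ‖u' s - u s‖ * w (t - s) ≤ v) :
    ‖x' t - x t‖ ≤ fadingGain (β (γ C)) γ w v := by
  refine le_ciInf fun ⟨r, (hr : 0 ≤ r)⟩ => ?_
  rw [max_eq_left hv]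
  have hwindow : ∀ s ∈ Ico t₀ t, t - r ≤ s → ‖u' s - u s‖ ≤ v / w r := fun s hs hrs => by
    rw [le_div_iff₀ (hw r hr)]
    exact (mul_le_mul_of_nonneg_left
      (hw_anti (sub_nonneg.2 hs.2.le) hr (sub_le_comm.1 hrs)) (norm_nonneg _)).trans (hle_v s hs)
  have hvw : 0 ≤ v / w r := div_nonneg hv (hw r hr).le
  rcases le_total t₀ (t - r) with hτ | hτ
  · have hinit : ‖x' (t - r) - x (t - r)‖ ≤ γ C := h.norm_sub_le_of_eq le_rfl hu hu' hx hx' heq hτ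
      hC fun s hs => hle_C s ⟨hs.1, hs.2.trans_le (sub_le_self t hr)⟩
    have hest := h.norm_sub_le hτ (hu.mono hτ) (hu'.mono hτ) (hx.restrict hτ le_rfl)
      (hx'.restrict hτ le_rfl) (sub_le_self t hr) hvw fun s hs =>
        hwindow s ⟨hτ.trans hs.1, hs.2⟩ hs.1
    rw [sub_sub_cancel] at hest
    exact hest.trans (add_le_add_left ((h.classKL.classK r hr).monotoneOn (norm_nonneg _)
      ((norm_nonneg _).trans hinit) hinit) _)
  · have hest := h.norm_sub_le_of_eq le_rfl hu hu' hx hx' heq ht hvw fun s hs =>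
      hwindow s hs (hτ.trans hs.1)
    exact hest.trans (le_add_of_nonneg_left (h.classKL.nonneg (h.classKInfty.nonneg hC) hr))

theorem exists_fading_memory_gain (h : IsDeltaISS t₀ f β γ) {w : ℝ → ℝ}
    (hw_anti : AntitoneOn w (Ici 0)) (hw : ∀ r, 0 ≤ r → 0 < w r) {C : ℝ} (hC : 0 ≤ C) :
    ∃ γ', ClassKInfty γ' ∧ ∀ (D : ℝ → ℝ) (u u' : ℝ → U) (x x' : ℝ → X),
      (∀ t, t₀ ≤ t → D t ≤ C) → IsAdmissibleInput t₀ u → IsAdmissibleInput t₀ u' →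
      (∀ t, t₀ ≤ t → ‖u' t - u t‖ ≤ D t) →
      IsSolutionOn (fun t ξ => f t ξ (u t)) univ t₀ ⊤ x →
      IsSolutionOn (fun t ξ => f t ξ (u' t)) univ t₀ ⊤ x' → x' t₀ = x t₀ →
      ∀ t, t₀ ≤ t → ‖x' t - x t‖ ≤ γ' (⨆ s : Ico t₀ t, D s * w (t - s)) := by
  have hγC := h.classKInfty.nonneg hC
  obtain ⟨γ', hγ', hle⟩ := exists_classKInfty_fadingGain_le (b := β (γ C))
    (fun _ => h.classKL.nonneg hγC) (h.classKL.tendsto_zero _ hγC) h.classKInfty.toClassK hw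
  refine ⟨γ', hγ', fun D u u' x x' hDC hu hu' hD hx hx' heq t ht => ?_⟩
  have hw' : ∀ s : Ico t₀ t, 0 < w (t - s) := fun s => hw _ (sub_nonneg.2 s.2.2.le)
  have hD_nonneg : ∀ s, t₀ ≤ s → 0 ≤ D s := fun s hs => (norm_nonneg _).trans (hD s hs)
  have hbdd : BddAbove (range fun s : Ico t₀ t => D s * w (t - s)) := by
    refine ⟨C * w 0, forall_mem_range.2 fun s => ?_⟩
    exact mul_le_mul (hDC s s.2.1) (hw_anti self_mem_Ici (sub_nonneg.2 s.2.2.le)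
      (sub_nonneg.2 s.2.2.le)) (hw' s).le hC
  have hsup_nonneg : 0 ≤ ⨆ s : Ico t₀ t, D s * w (t - s) :=
    Real.iSup_nonneg fun s => mul_nonneg (hD_nonneg s s.2.1) (hw' s).le
  refine le_trans ?_ (hle _ hsup_nonneg)
  refine h.norm_sub_le_fadingGain hw_anti hw hu hu' hx hx' heq hC ht
    (fun s hs => (hD s hs.1).trans (hDC s hs.1)) hsup_nonneg fun s hs => ?_
  exact (mul_le_mul_of_nonneg_right (hD s hs.1) (hw' ⟨s, hs⟩).le).trans (le_ciSup hbdd ⟨s, hs⟩)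

end IsDeltaISS

end DeltaISS

/-! ### Separating potentials -/

section SeparatingPotential

theorem exists_nonneg_combination_inner_pos {ι E : Type*} [Fintype ι] [NormedAddCommGroup E]
    [InnerProductSpace ℝ E] {B : ι → E} {φ : E} (hφ : ∀ i, 0 < inner ℝ φ (B i)) :
    ∃ α : ι → ℝ, (∀ i, 0 ≤ α i) ∧ ∀ i, 0 < inner ℝ (∑ j, α j • B j) (B i) := by
  classical
  rcases isEmpty_or_nonempty ι with _ | _
  · exact ⟨0, fun i => isEmptyElim i, fun i => isEmptyElim i⟩
  -- The point of least norm in the convex hull of the `B i` has a positive inner product with all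
  -- of them; it is nonzero since the hull lies in the half-space `{x | 0 < ⟪φ, x⟫}`.
  set Λ := Fintype.linearCombination ℝ B
  have hmem : ∀ i, Pi.single i 1 ∈ stdSimplex ℝ ι := single_mem_stdSimplex ℝ
  have hconv : Convex ℝ (Λ '' stdSimplex ℝ ι) := (convex_stdSimplex ℝ ι).linear_image Λ
  have hcompact : IsCompact (Λ '' stdSimplex ℝ ι) :=
    (isCompact_stdSimplex ℝ ι).image Λ.continuous_of_finiteDimensional
  obtain ⟨_, ⟨α, hα, rfl⟩, hmin⟩ := exists_norm_eq_iInf_of_complete_convex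
    ((isPathConnected_stdSimplex ι).nonempty.image Λ) hcompact.isComplete hconv 0
  rw [norm_eq_iInf_iff_real_inner_le_zero hconv ⟨α, hα, rfl⟩] at hmin
  have hpos : 0 < inner ℝ φ (Λ α) := by
    obtain ⟨i, -, hi⟩ := Finset.exists_lt_of_sum_lt (s := Finset.univ) (f := fun _ => (0 : ℝ))
      (g := α) (by simp [hα.2])
    rw [Fintype.linearCombination_apply, inner_sum]
    refine Finset.sum_pos' (fun j _ => ?_) ⟨i, Finset.mem_univ i, ?_⟩ <;> rw [inner_smul_right]
    · exact mul_nonneg (hα.1 j) (hφ j).le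
    · exact mul_pos hi (hφ i)
  refine ⟨α, hα.1, fun i => ?_⟩
  have hi := hmin (B i) ⟨Pi.single i 1, hmem i, by simp [Λ, Fintype.linearCombination_apply_single]⟩
  rw [zero_sub, inner_neg_left, inner_sub_right, neg_nonpos, sub_nonneg] at hi
  refine lt_of_lt_of_le (real_inner_self_pos.2 fun h0 => ?_) hi
  simp [h0] at hpos

variable {V : Type*} [Fintype V]

theorem exists_separating_potential (K : Finset (V × V)) {φ : V → ℝ}
    (hφ : ∀ e ∈ K, φ e.2 < φ e.1) :
    ∃ (α : K → ℝ) (v : V → ℝ), (∀ e, 0 ≤ α e) ∧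
      (∀ y : V → ℝ, ∑ k, v k * y k = ∑ e : K, α e * (y e.1.1 - y e.1.2)) ∧
      ∀ e ∈ K, v e.2 < v e.1 := by
  classical
  let B : K → EuclideanSpace ℝ V := fun e =>
    EuclideanSpace.single e.1.1 (1 : ℝ) - EuclideanSpace.single e.1.2 (1 : ℝ)
  have hB : ∀ (u : EuclideanSpace ℝ V) e, inner ℝ u (B e) = u e.1.1 - u e.1.2 := fun u e => by
    simp [B, inner_sub_right, EuclideanSpace.inner_single_right]
  obtain ⟨α, hα, hv⟩ := exists_nonneg_combination_inner_pos (B := B) (φ := WithLp.toLp 2 φ)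
    fun e => by simpa only [hB] using sub_pos.2 (hφ e e.2)
  set u := ∑ e, α e • B e with hu
  refine ⟨α, u, hα, fun y => ?_, fun e he => ?_⟩
  · calc ∑ k, u k * y k = inner ℝ (WithLp.toLp 2 y) u := by simp [PiLp.inner_apply]
      _ = ∑ e, α e * (y e.1.1 - y e.1.2) := by simp only [hu, inner_sum, inner_smul_right, hB]
  · simpa only [hB, sub_pos] using hv ⟨e, he⟩

end SeparatingPotential

/-! ### Scalar nodes with antisymmetric coupling -/

theorem sum_mul_sum_antisymm {V : Type*} [Fintype V] {g : V → V → ℝ}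
    (hg : ∀ i j, g i j = -g j i) (v : V → ℝ) :
    ∑ i, v i * ∑ j, g i j = -(1 / 2) * ∑ i, ∑ j, (v j - v i) * g i j := by
  have hswap : ∑ i, ∑ j, v j * g i j = -∑ i, ∑ j, v i * g i j := by
    rw [Finset.sum_comm]
    simp only [← Finset.sum_neg_distrib]
    refine Finset.sum_congr rfl fun i _ => Finset.sum_congr rfl fun j _ => ?_
    rw [hg j i, mul_neg]
  simp only [sub_mul, Finset.sum_sub_distrib, hswap, Finset.mul_sum]
  ring

theorem abs_add_sum_le_of_dissipative {V : Type*} [Fintype V] {y F : V → ℝ} {g : V → V → ℝ}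
    {B M C κ : ℝ} (hy : ∀ i, |y i| ≤ B) (hF : ∀ i, |F i| ≤ M) (hg : ∀ i j, g i j = -g j i)
    (hκ : 0 < κ) (hdiss : ∀ i j, κ * |g i j| ≤ (y j - y i) * g i j + C) (i : V) :
    |F i + ∑ j, g i j| ≤
      M + κ⁻¹ * (2 * (Fintype.card V * (B * M)) + Fintype.card V * (Fintype.card V * C)) -
        κ⁻¹ * ∑ k, 2 * y k * (F k + ∑ j, g k j) := by
  have hcoupling : |∑ j, g i j| ≤ ∑ k, ∑ j, |g k j| :=
    (Finset.abs_sum_le_sum_abs _ _).trans (Finset.single_le_sum (f := fun k => ∑ j, |g k j|)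
      (fun k _ => Finset.sum_nonneg fun j _ => abs_nonneg _) (Finset.mem_univ i))
  have hdrift : ∑ k, y k * F k ≤ Fintype.card V * (B * M) := by
    refine (Finset.sum_le_card_nsmul _ _ (B * M) fun k _ => ?_).trans_eq (by simp)
    refine (le_abs_self _).trans ((abs_mul _ _).trans_le ?_)
    exact mul_le_mul (hy k) (hF k) (abs_nonneg _) ((abs_nonneg _).trans (hy k))
  have hsum : κ * ∑ k, ∑ j, |g k j| ≤
      ∑ k, ∑ j, (y j - y k) * g k j + Fintype.card V * (Fintype.card V * C) :=
    calc κ * ∑ k, ∑ j, |g k j| ≤ ∑ k, ∑ j, ((y j - y k) * g k j + C) := by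
          simp only [Finset.mul_sum]
          exact Finset.sum_le_sum fun k _ => Finset.sum_le_sum fun j _ => hdiss k j
      _ = _ := by simp [Finset.sum_add_distrib]
  have henergy : ∑ k, 2 * y k * (F k + ∑ j, g k j) =
      2 * ∑ k, y k * F k - ∑ k, ∑ j, (y j - y k) * g k j := by
    simp only [mul_assoc, ← Finset.mul_sum, mul_add, Finset.sum_add_distrib,
      sum_mul_sum_antisymm hg]
    ring
  rw [add_sub_assoc, ← mul_sub]
  refine (abs_add_le _ _).trans (add_le_add (hF i) (hcoupling.trans ?_))
  rw [le_inv_mul_iff₀ hκ, henergy]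
  linarith

/-- Real node trajectories `y i` on `[a, b)` with the dynamics `yᵢ' = Fᵢ + ∑ⱼ gᵢⱼ`, a drift `F`
bounded by `M`, and an antisymmetric coupling `g`. Drift and coupling are recorded as functions of
time along the trajectories. -/
structure IsCoupledOn {V : Type*} [Fintype V] (y F : V → ℝ → ℝ) (g : V → V → ℝ → ℝ)
    (M a b : ℝ) : Prop where
  hasAEDerivOn : ∀ i, ∀ T ∈ Ico a b, HasAEDerivOn (y i) (fun t => F i t + ∑ j, g i j t) a T
  abs_drift_le : ∀ i, ∀ t ∈ Ico a b, |F i t| ≤ M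
  antisymm : ∀ i j, ∀ t ∈ Ico a b, g i j t = -g j i t

theorem HasAEDerivOn.exists_lt_of_tendsto_deriv_atBot {f f' : ℝ → ℝ} {a b l : ℝ} (hab : a < b)
    (hf : ∀ T ∈ Ico a b, HasAEDerivOn f f' a T) (hf' : Tendsto f' (𝓝[<] b) atBot)
    (hl : Tendsto f (𝓝[<] b) (𝓝 l)) : ∃ t ∈ Ico a b, l < f t := by
  obtain ⟨c, hcb, hc⟩ := (mem_nhdsLT_iff_exists_Ioo_subset' hab).1
    (hf'.eventually_le_atBot (-1))
  obtain ⟨s, hs, hsb⟩ := exists_between (max_lt hab hcb)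
  rw [max_lt_iff] at hs
  refine ⟨s, ⟨hs.1.le, hsb⟩, ?_⟩
  have hdecr : ∀ᶠ t in 𝓝[<] b, f t ≤ f s - (t - s) := by
    filter_upwards [Ioo_mem_nhdsLT hsb] with t ht
    have hst := ((hf t ⟨(hs.1.trans ht.1).le, ht.2⟩).mono hs.1.le ht.1.le le_rfl).sub_le_sub
      (hasAEDerivOn_const_mul (-1) s t) ht.1.le fun r hr => hc ⟨hs.2.trans hr.1, hr.2.trans ht.2⟩
    linarith
  have hlim : Tendsto (fun t => f s - (t - s)) (𝓝[<] b) (𝓝 (f s - (b - s))) :=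
    (Continuous.tendsto (by fun_prop) b).mono_left nhdsWithin_le_nhds
  linarith [le_of_tendsto_of_tendsto hl hlim hdecr]

theorem tendsto_finsetSum_atTop {ι α : Type*} {l : Filter α} {s : Finset ι} {f : ι → α → ℝ}
    {i : ι} (hi : i ∈ s) (hf : Tendsto (f i) l atTop)
    (hbdd : ∀ j ∈ s, ∃ R, ∀ᶠ x in l, R ≤ f j x) :
    Tendsto (fun x => ∑ j ∈ s, f j x) l atTop := by
  classical
  choose! R hR using hbdd
  simp only [← Finset.add_sum_erase s _ hi]
  refine tendsto_atTop_add_right_of_le' l (∑ j ∈ s.erase i, R j) hf ?_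
  have hall := (Filter.eventually_all_finset (s.erase i)).2 fun j hj =>
    hR j (Finset.mem_of_mem_erase hj)
  filter_upwards [hall] with x hx using Finset.sum_le_sum hx

namespace IsCoupledOn

variable {V : Type*} [Fintype V] {y F : V → ℝ → ℝ} {g : V → V → ℝ → ℝ} {M a b : ℝ}

theorem exists_tendsto_of_dissipative {B C κ : ℝ} (h : IsCoupledOn y F g M a b) (hab : a < b)
    (hy : ∀ i, ∀ t ∈ Ico a b, |y i t| ≤ B) (hκ : 0 < κ)
    (hdiss : ∀ i j, ∀ t ∈ Ico a b, κ * |g i j t| ≤ (y j t - y i t) * g i j t + C) (i : V) :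
    ∃ l, Tendsto (y i) (𝓝[<] b) (𝓝 l) := by
  obtain ⟨c, hc⟩ : ∃ c, ∀ t ∈ Ico a b, |F i t + ∑ j, g i j t| ≤
      c - κ⁻¹ * ∑ k, 2 * y k t * (F k t + ∑ j, g k j t) :=
    ⟨_, fun t ht => abs_add_sum_le_of_dissipative (fun k => hy k t ht)
      (fun k => h.abs_drift_le k t ht) (fun k j => h.antisymm k j t ht) hκ
      (fun k j => hdiss k j t ht) i⟩
  set H : ℝ → ℝ := fun t => c * t - κ⁻¹ * ∑ k, y k t ^ 2
  refine exists_tendsto_of_norm_sub_le_sub (h := H) (C := max (c * a) (c * b)) hab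
    (fun s hs t ht => ?_) fun t ht => ?_
  · have hderiv : HasAEDerivOn H _ a t := (hasAEDerivOn_const_mul c a t).sub
      ((HasAEDerivOn.sum _ fun k _ =>
        (h.hasAEDerivOn k t ⟨hs.1.trans ht.1, ht.2⟩).sq).const_mul κ⁻¹)
    exact ((h.hasAEDerivOn i t ⟨hs.1.trans ht.1, ht.2⟩).mono hs.1 ht.1 le_rfl).norm_sub_le_sub
      (hderiv.mono hs.1 ht.1 le_rfl) ht.1
      fun r hr => hc r ⟨hs.1.trans hr.1.le, hr.2.trans ht.2⟩
  · have hlin : c * t ≤ max (c * a) (c * b) := by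
      rcases le_total 0 c with hc0 | hc0
      · exact (mul_le_mul_of_nonneg_left ht.2.le hc0).trans (le_max_right _ _)
      · exact (mul_le_mul_of_nonpos_left ht.1 hc0).trans (le_max_left _ _)
    have hsq : 0 ≤ κ⁻¹ * ∑ k, y k t ^ 2 := by positivity
    linarith

theorem tendsto_sum_mul_deriv_atBot (h : IsCoupledOn y F g M a b) (hab : a < b)
    {K : Set (V × V)} (hK : K.Nonempty) {v : V → ℝ} (hv : ∀ e ∈ K, v e.2 < v e.1)
    (hblow : ∀ e ∈ K, Tendsto (g e.1 e.2) (𝓝[<] b) atBot)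
    (hrest : ∀ i j, (i, j) ∉ K → (j, i) ∉ K → ∃ R, ∀ᶠ t in 𝓝[<] b, |g i j t| ≤ R) :
    Tendsto (fun t => ∑ k, v k * (F k t + ∑ j, g k j t)) (𝓝[<] b) atBot := by
  have hnhds : ∀ᶠ t in 𝓝[<] b, t ∈ Ico a b :=
    mem_of_superset (Ioo_mem_nhdsLT hab) Ioo_subset_Ico_self
  set f : V × V → ℝ → ℝ := fun e t => (v e.2 - v e.1) * g e.1 e.2 t with hf
  have hfK : ∀ e ∈ K, Tendsto (f e) (𝓝[<] b) atTop := fun e he =>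
    (hblow e he).const_mul_atBot_of_neg (sub_neg.2 (hv e he))
  have hbdd : ∀ e, ∃ R, ∀ᶠ t in 𝓝[<] b, R ≤ f e t := by
    intro e
    by_cases h₁ : e ∈ K
    · exact ⟨0, (hfK e h₁).eventually_ge_atTop 0⟩
    by_cases h₂ : e.swap ∈ K
    · refine ⟨0, ?_⟩
      filter_upwards [(hfK _ h₂).eventually_ge_atTop 0, hnhds] with t ht hmem
      refine ht.trans_eq ?_
      simp only [hf, Prod.fst_swap, Prod.snd_swap]
      rw [h.antisymm e.2 e.1 t hmem]
      ring
    · obtain ⟨R, hR⟩ := hrest e.1 e.2 h₁ h₂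
      refine ⟨-(|v e.2 - v e.1| * R), ?_⟩
      filter_upwards [hR] with t ht
      refine (neg_le_neg ?_).trans (neg_abs_le _)
      exact (abs_mul _ _).trans_le (mul_le_mul_of_nonneg_left ht (abs_nonneg _))
  obtain ⟨e₀, he₀⟩ := hK
  have hsum := tendsto_finsetSum_atTop (Finset.mem_univ e₀) (hfK e₀ he₀) fun e _ => hbdd e
  refine tendsto_atBot_mono' _ ?_ (tendsto_atBot_add_const_left _ (∑ k, |v k| * M)
    (hsum.const_mul_atTop_of_neg (show -(1 / 2) < (0 : ℝ) by norm_num)))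
  filter_upwards [hnhds] with t ht
  simp only [mul_add, Finset.sum_add_distrib, sum_mul_sum_antisymm (h.antisymm · · t ht) v,
    Fintype.sum_prod_type, hf]
  refine add_le_add_left (Finset.sum_le_sum fun k _ => ?_) _
  exact (le_abs_self _).trans ((abs_mul _ _).trans_le
    (mul_le_mul_of_nonneg_left (h.abs_drift_le k t ht) (abs_nonneg _)))

theorem not_attains_barriers (h : IsCoupledOn y F g M a b) (hab : a < b) {K : Finset (V × V)}
    (hK : K.Nonempty) {ψ ψ' : V × V → ℝ → ℝ} {L : ℝ} {ys : V → ℝ}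
    (hψ : ∀ e ∈ K, HasAEDerivOn (ψ e) (ψ' e) a b) (hψ' : ∀ e ∈ K, ∀ t ∈ Ico a b, |ψ' e t| ≤ L)
    (hbar : ∀ e ∈ K, ∀ t ∈ Ico a b, y e.1 t - y e.2 t ≤ ψ e t)
    (hlim : ∀ i, Tendsto (y i) (𝓝[<] b) (𝓝 (ys i)))
    (hatt : ∀ e ∈ K, ys e.1 - ys e.2 = ψ e b) (hsep : ∀ e ∈ K, ys e.2 < ys e.1)
    (hblow : ∀ e ∈ K, Tendsto (g e.1 e.2) (𝓝[<] b) atBot)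
    (hrest : ∀ i j, (i, j) ∉ K → (j, i) ∉ K → ∃ R, ∀ᶠ t in 𝓝[<] b, |g i j t| ≤ R) : False := by
  classical
  obtain ⟨α, v, hα, hv, hvK⟩ := exists_separating_potential K hsep
  set W : ℝ → ℝ := fun t => ∑ k, v k * y k t - ∑ e : K, α e * ψ e t with hW
  have hW_eq : ∀ t, W t = ∑ e : K, α e * (y e.1.1 t - y e.1.2 t - ψ e t) := fun t => by
    simp only [hW, hv (y · t), ← Finset.sum_sub_distrib, ← mul_sub]
  have hW_deriv : ∀ T ∈ Ico a b, HasAEDerivOn W _ a T := fun T hT =>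
    (HasAEDerivOn.sum _ fun k _ => (h.hasAEDerivOn k T hT).const_mul (v k)).sub
      (HasAEDerivOn.sum _ fun e _ => ((hψ e.1 e.2).mono le_rfl hT.1 hT.2.le).const_mul (α e))
  have hW_atBot : Tendsto (fun t => ∑ k, v k * (F k t + ∑ j, g k j t) - ∑ e : K, α e * ψ' e t)
      (𝓝[<] b) atBot := by
    refine tendsto_atBot_mono' _ ?_ (tendsto_atBot_add_const_right _ (∑ e : K, α e * L)
      (h.tendsto_sum_mul_deriv_atBot hab hK.to_set hvK hblow hrest))
    filter_upwards [Ioo_mem_nhdsLT hab] with t ht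
    rw [sub_eq_add_neg, ← Finset.sum_neg_distrib]
    simp only [← mul_neg]
    gcongr with e
    · exact hα e
    · exact (neg_le_abs _).trans (hψ' e.1 e.2 t (Ioo_subset_Ico_self ht))
  have hW_lim : Tendsto W (𝓝[<] b) (𝓝 0) := by
    have hψlim : ∀ e ∈ K, Tendsto (ψ e) (𝓝[<] b) (𝓝 (ys e.1 - ys e.2)) := fun e he => by
      have hcont := (hψ e he).absolutelyContinuous.continuousOn
      rw [uIcc_of_le hab.le] at hcont
      exact hatt e he ▸ (hcont b (right_mem_Icc.2 hab.le)).mono_left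
        (nhdsWithin_le_of_mem (Icc_mem_nhdsLT hab))
    simp only [funext hW_eq]
    convert tendsto_finsetSum Finset.univ fun (e : K) _ =>
      (((hlim e.1.1).sub (hlim e.1.2)).sub (hψlim e.1 e.2)).const_mul (α e)
    simp
  obtain ⟨t, ht, hlt⟩ := HasAEDerivOn.exists_lt_of_tendsto_deriv_atBot hab hW_deriv hW_atBot hW_lim
  rw [hW_eq] at hlt
  exact hlt.not_ge (Finset.sum_nonpos fun e _ =>
    mul_nonpos_of_nonneg_of_nonpos (hα e) (sub_nonpos.2 (hbar e.1 e.2 t ht)))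

end IsCoupledOn

/-! ### Funnel coupling of scalar nodes -/

theorem div_mem_Ioo_of_abs_lt {u c : ℝ} (h : |u| < c) : u / c ∈ Ioo (-1 : ℝ) 1 := by
  have hc : 0 < c := (abs_nonneg u).trans_lt h
  rwa [mem_Ioo, ← abs_lt, abs_div, abs_of_pos hc, div_lt_one hc]

theorem exists_dissipativity_bound {μ : ℝ → ℝ} (hcont : ContinuousOn μ (Ioo (-1) 1))
    (htop : Tendsto μ (𝓝[<] 1) atTop) (hbot : Tendsto μ (𝓝[>] (-1)) atBot) :
    ∃ C, 0 ≤ C ∧ ∀ r ∈ Ioo (-1 : ℝ) 1, 1 / 2 * |μ r| ≤ r * μ r + C := by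
  obtain ⟨p, hp, hp'⟩ := (mem_nhdsLT_iff_exists_Ioo_subset' (show (1 / 2 : ℝ) < 1 by norm_num)).1
    ((htop.eventually_ge_atTop 0).and (Ioo_mem_nhdsLT (show (1 / 2 : ℝ) < 1 by norm_num)))
  obtain ⟨q, hq, hq'⟩ := (mem_nhdsGT_iff_exists_Ioo_subset'
    (show (-1 : ℝ) < -(1 / 2) by norm_num)).1
    ((hbot.eventually_le_atBot 0).and (Ioo_mem_nhdsGT (show (-1 : ℝ) < -(1 / 2) by norm_num)))
  obtain ⟨C, hC⟩ := (isCompact_Icc (a := q) (b := p)).exists_bound_of_continuousOn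
    (hcont.mono fun r hr => ⟨(mem_Ioi.1 hq).trans_le hr.1, hr.2.trans_lt (mem_Iio.1 hp)⟩)
  refine ⟨2 * |C|, by positivity, fun r hr => ?_⟩
  have hC0 := abs_nonneg C
  rcases lt_or_ge p r with hpr | hrp
  · obtain ⟨hμ, hr'⟩ := hp' ⟨hpr, hr.2⟩
    rw [abs_of_nonneg hμ]
    linarith [mul_le_mul_of_nonneg_right hr'.1.le hμ]
  rcases lt_or_ge r q with hrq | hqr
  · obtain ⟨hμ, hr'⟩ := hq' ⟨hr.1, hrq⟩
    rw [abs_of_nonpos hμ]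
    linarith [mul_le_mul_of_nonpos_right hr'.2.le hμ]
  · have hμ : |μ r| ≤ |C| := (hC r ⟨hqr, hrp⟩).trans (le_abs_self C)
    have hrμ : |r * μ r| ≤ |μ r| := by
      rw [abs_mul]
      exact mul_le_of_le_one_left (abs_nonneg _) (abs_le.2 ⟨hr.1.le, hr.2.le⟩)
    linarith [neg_abs_le (r * μ r)]

namespace Network

variable {N m : ℕ} {n d : Fin N → ℕ}

/-- The part of the funnel that concerns the `p`-th output components `y`. -/
def componentFunnel (S : Network N m n d) (p : Fin m) : Set (ℝ × (Fin N → ℝ)) :=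
  {q | ∀ i j, S.graph.Adj i j → |q.2 j - q.2 i| < S.ψ i j p q.1}

open Classical in
/-- The `p`-th component of the coupling of node `i` to node `j` at output components `y`, extended
by zero to pairs of nodes which are not adjacent. -/
def edgeForce (S : Network N m n d) (p : Fin m) (t : ℝ) (y : Fin N → ℝ) (i j : Fin N) : ℝ :=
  if S.graph.Adj i j then S.μ i j p ((y j - y i) / S.ψ i j p t) else 0

variable {S : Network N m n d} {t₀ : ℝ} {p : Fin m}

theorem edgeForce_of_adj {i j : Fin N} (hij : S.graph.Adj i j) (t : ℝ) (y : Fin N → ℝ) :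
    S.edgeForce p t y i j = S.μ i j p ((y j - y i) / S.ψ i j p t) :=
  if_pos hij

theorem edgeForce_of_not_adj {i j : Fin N} (hij : ¬S.graph.Adj i j) (t : ℝ) (y : Fin N → ℝ) :
    S.edgeForce p t y i j = 0 :=
  if_neg hij

namespace DesignFunctions

theorem continuousWithinAt_ψ (h : S.DesignFunctions t₀) {i j : Fin N} (hij : S.graph.Adj i j)
    (p : Fin m) {b : ℝ} (hb : t₀ < b) : ContinuousWithinAt (S.ψ i j p) (Iio b) b :=
  ((h.ψ_contDiff i j hij p).continuousOn.continuousAt (Ici_mem_nhds hb)).continuousWithinAt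

theorem edgeForce_antisymm (h : S.DesignFunctions t₀) {t : ℝ} (ht : t₀ ≤ t) {y : Fin N → ℝ}
    (hy : (t, y) ∈ S.componentFunnel p) (i j : Fin N) :
    S.edgeForce p t y i j = -S.edgeForce p t y j i := by
  by_cases hij : S.graph.Adj i j
  · rw [edgeForce_of_adj hij, edgeForce_of_adj hij.symm,
      ← h.μ_symm i j hij p _ (div_mem_Ioo_of_abs_lt (hy j i hij.symm)), h.ψ_symm i j hij p t ht,
      ← neg_div, neg_sub]
  · rw [edgeForce_of_not_adj hij, edgeForce_of_not_adj (mt SimpleGraph.Adj.symm hij), neg_zero]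

theorem exists_pos_le_ψ (h : S.DesignFunctions t₀) (p : Fin m) {b : ℝ} (hb : t₀ ≤ b) :
    ∃ κ, 0 < κ ∧ ∀ i j, S.graph.Adj i j → ∀ t ∈ Icc t₀ b, κ ≤ S.ψ i j p t := by
  have hedge : ∀ i j, ∀ᶠ κ in 𝓝[>] (0 : ℝ),
      S.graph.Adj i j → ∀ t ∈ Icc t₀ b, κ ≤ S.ψ i j p t := by
    intro i j
    by_cases hij : S.graph.Adj i j
    · obtain ⟨s, hs, hmin⟩ := isCompact_Icc.exists_isMinOn (nonempty_Icc.2 hb)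
        ((h.ψ_contDiff i j hij p).continuousOn.mono Icc_subset_Ici_self)
      filter_upwards [Ioo_mem_nhdsGT (h.ψ_pos i j hij p s hs.1)] with κ hκ _ t ht
      exact hκ.2.le.trans (hmin ht)
    · exact Eventually.of_forall fun κ hij' => (hij hij').elim
  obtain ⟨κ, hκ, hpos⟩ :=
    ((eventually_all.2 fun i => eventually_all.2 (hedge i)).and self_mem_nhdsWithin).exists
  exact ⟨κ, hpos, hκ⟩

theorem exists_dissipative_edge (h : S.DesignFunctions t₀) {i j : Fin N} (hij : S.graph.Adj i j)
    (p : Fin m) : ∃ C, ∀ t, t₀ ≤ t → ∀ ν, |ν| < S.ψ i j p t →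
      S.ψ i j p t / 2 * |S.μ i j p (ν / S.ψ i j p t)| ≤ ν * S.μ i j p (ν / S.ψ i j p t) + C := by
  obtain ⟨C, hC0, hC⟩ := exists_dissipativity_bound (h.μ_continuousOn i j hij p)
    (h.μ_atTop i j hij p) (h.μ_atBot i j hij p)
  obtain ⟨P, hP⟩ := h.ψ_bounded i j hij p
  refine ⟨|P| * C, fun t ht ν hν => ?_⟩
  have hψ := h.ψ_pos i j hij p t ht
  set r := ν / S.ψ i j p t with hr
  calc S.ψ i j p t / 2 * |S.μ i j p r| = S.ψ i j p t * (1 / 2 * |S.μ i j p r|) := by ring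
    _ ≤ S.ψ i j p t * (r * S.μ i j p r + C) :=
        mul_le_mul_of_nonneg_left (hC r (div_mem_Ioo_of_abs_lt hν)) hψ.le
    _ = ν * S.μ i j p r + S.ψ i j p t * C := by rw [hr]; field_simp
    _ ≤ ν * S.μ i j p r + |P| * C :=
        add_le_add_right (mul_le_mul_of_nonneg_right ((hP t ht).trans (le_abs_self P)) hC0) _

theorem exists_dissipative_edgeForce (h : S.DesignFunctions t₀) (p : Fin m) {b : ℝ}
    (hb : t₀ ≤ b) : ∃ κ C, 0 < κ ∧ ∀ t ∈ Icc t₀ b, ∀ y, (t, y) ∈ S.componentFunnel p →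
      ∀ i j, κ * |S.edgeForce p t y i j| ≤ (y j - y i) * S.edgeForce p t y i j + C := by
  obtain ⟨κ, hκ, hκψ⟩ := h.exists_pos_le_ψ p hb
  choose! C hC using fun (i j : Fin N) (hij : S.graph.Adj i j) =>
    h.exists_dissipative_edge hij p
  obtain ⟨R, hR⟩ := (Set.finite_range fun e : Fin N × Fin N => C e.1 e.2).bddAbove
  refine ⟨κ / 2, max R 0, by positivity, fun t ht y hy i j => ?_⟩
  by_cases hij : S.graph.Adj i j
  · rw [edgeForce_of_adj hij]
    calc κ / 2 * |S.μ i j p ((y j - y i) / S.ψ i j p t)|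
        ≤ S.ψ i j p t / 2 * |S.μ i j p ((y j - y i) / S.ψ i j p t)| := by
          gcongr
          exact hκψ i j hij t ht
      _ ≤ _ := hC i j hij t ht.1 _ (hy i j hij)
      _ ≤ _ := add_le_add_right ((hR ⟨(i, j), rfl⟩).trans (le_max_left _ _)) _
  · simp [edgeForce_of_not_adj hij]

section Limits

variable {y : Fin N → ℝ → ℝ} {ys : Fin N → ℝ} {b : ℝ} {i j : Fin N}

theorem tendsto_ratio (h : S.DesignFunctions t₀) (hb : t₀ < b)
    (hlim : ∀ k, Tendsto (y k) (𝓝[<] b) (𝓝 (ys k))) (hij : S.graph.Adj i j) :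
    Tendsto (fun t => (y j t - y i t) / S.ψ i j p t) (𝓝[<] b)
      (𝓝 ((ys j - ys i) / S.ψ i j p b)) :=
  ((hlim j).sub (hlim i)).div (h.continuousWithinAt_ψ hij p hb) (h.ψ_pos i j hij p b hb.le).ne'

theorem tendsto_edgeForce_atBot (h : S.DesignFunctions t₀) (hb : t₀ < b)
    (hy : ∀ᶠ t in 𝓝[<] b, (t, fun k => y k t) ∈ S.componentFunnel p)
    (hlim : ∀ k, Tendsto (y k) (𝓝[<] b) (𝓝 (ys k))) (hij : S.graph.Adj i j)
    (hatt : ys i - ys j = S.ψ i j p b) :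
    Tendsto (fun t => S.edgeForce p t (fun k => y k t) i j) (𝓝[<] b) atBot := by
  have hratio : (ys j - ys i) / S.ψ i j p b = -1 := by
    rw [← neg_sub, hatt, neg_div, div_self (h.ψ_pos i j hij p b hb.le).ne']
  simp only [edgeForce_of_adj hij]
  refine (h.μ_atBot i j hij p).comp
    (tendsto_nhdsWithin_iff.2 ⟨hratio ▸ h.tendsto_ratio hb hlim hij, ?_⟩)
  filter_upwards [hy] with t ht using (div_mem_Ioo_of_abs_lt (ht i j hij)).1

theorem exists_eventually_abs_edgeForce_le (h : S.DesignFunctions t₀) (hb : t₀ < b)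
    (hlim : ∀ k, Tendsto (y k) (𝓝[<] b) (𝓝 (ys k)))
    (hij : S.graph.Adj i j → |ys j - ys i| < S.ψ i j p b) :
    ∃ R, ∀ᶠ t in 𝓝[<] b, |S.edgeForce p t (fun k => y k t) i j| ≤ R := by
  by_cases hadj : S.graph.Adj i j
  · have hcont := ((h.μ_continuousOn i j hadj p).continuousAt
      (isOpen_Ioo.mem_nhds (div_mem_Ioo_of_abs_lt (hij hadj)))).tendsto.comp
        (h.tendsto_ratio hb hlim hadj)
    simp only [edgeForce_of_adj hadj]
    exact ⟨_, hcont.abs.eventually_le_const (lt_add_one _)⟩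
  · exact ⟨0, by simp [edgeForce_of_not_adj hadj]⟩

theorem limit_mem_componentFunnel (h : S.DesignFunctions t₀) {F : Fin N → ℝ → ℝ} {M : ℝ}
    (hb : t₀ < b)
    (hc : IsCoupledOn y F (fun i j t => S.edgeForce p t (fun k => y k t) i j) M t₀ b)
    (hy : ∀ t ∈ Ico t₀ b, (t, fun k => y k t) ∈ S.componentFunnel p)
    (hlim : ∀ k, Tendsto (y k) (𝓝[<] b) (𝓝 (ys k))) : (b, ys) ∈ S.componentFunnel p := by
  classical
  have hy' : ∀ᶠ t in 𝓝[<] b, (t, fun k => y k t) ∈ S.componentFunnel p := by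
    filter_upwards [Ioo_mem_nhdsLT hb] with t ht using hy t (Ioo_subset_Ico_self ht)
  have hle : ∀ i j, S.graph.Adj i j → |ys j - ys i| ≤ S.ψ i j p b := fun i j hij =>
    le_of_tendsto_of_tendsto ((hlim j).sub (hlim i)).abs (h.continuousWithinAt_ψ hij p hb)
      (hy'.mono fun t ht => (ht i j hij).le)
  let K : Finset (Fin N × Fin N) := {e | S.graph.Adj e.1 e.2 ∧ ys e.1 - ys e.2 = S.ψ e.1 e.2 p b}
  have hK : ∀ {e}, e ∈ K → S.graph.Adj e.1 e.2 ∧ ys e.1 - ys e.2 = S.ψ e.1 e.2 p b := fun he =>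
    (Finset.mem_filter.1 he).2
  have hstrict : ∀ i j, (i, j) ∉ K → (j, i) ∉ K → S.graph.Adj i j →
      |ys j - ys i| < S.ψ i j p b := by
    intro i j hij hji hadj
    refine (hle i j hadj).lt_of_ne fun heq => ?_
    rcases abs_choice (ys j - ys i) with habs | habs
    · exact hji (by simp [K, hadj.symm, ← h.ψ_symm i j hadj p b hb.le, ← heq, habs])
    · exact hij (by simp [K, hadj, ← heq, habs])
  suffices hempty : K = ∅ from
    fun i j hij => hstrict i j (by simp [hempty]) (by simp [hempty]) hij
  by_contra hne
  choose! L hL using fun (i j : Fin N) (hij : S.graph.Adj i j) => h.ψ_deriv_bounded i j hij p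
  obtain ⟨R, hR⟩ := (Set.finite_range fun e : Fin N × Fin N => L e.1 e.2).bddAbove
  exact hc.not_attains_barriers hb (Finset.nonempty_iff_ne_empty.2 hne)
    (fun e he => HasAEDerivOn.of_contDiffOn hb.le (h.ψ_contDiff e.1 e.2 (hK he).1 p))
    (fun e he t ht => (hL e.1 e.2 (hK he).1 t ht.1).trans (hR ⟨e, rfl⟩))
    (fun e he t ht => (le_abs_self _).trans
      ((abs_sub_comm _ _).trans_le (hy t ht e.1 e.2 (hK he).1).le)) hlim
    (fun e he => (hK he).2)
    (fun e he => sub_pos.1 ((hK he).2 ▸ h.ψ_pos e.1 e.2 (hK he).1 p b hb.le))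
    (fun e he => h.tendsto_edgeForce_atBot hb hy' hlim (hK he).1 (hK he).2)
    fun i j hij hji => h.exists_eventually_abs_edgeForce_le hb hlim (hstrict i j hij hji)

theorem exists_limit_mem_componentFunnel (h : S.DesignFunctions t₀) {F : Fin N → ℝ → ℝ} {B M : ℝ}
    (hb : t₀ < b)
    (hc : IsCoupledOn y F (fun i j t => S.edgeForce p t (fun k => y k t) i j) M t₀ b)
    (hB : ∀ i, ∀ t ∈ Ico t₀ b, |y i t| ≤ B)
    (hy : ∀ t ∈ Ico t₀ b, (t, fun k => y k t) ∈ S.componentFunnel p) :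
    ∃ ys : Fin N → ℝ, (∀ k, Tendsto (y k) (𝓝[<] b) (𝓝 (ys k))) ∧ (b, ys) ∈ S.componentFunnel p := by
  obtain ⟨κ, C, hκ, hC⟩ := h.exists_dissipative_edgeForce p hb.le
  choose ys hys using hc.exists_tendsto_of_dissipative hb hB hκ fun i j t ht =>
    hC t (Ico_subset_Icc_self ht) _ (hy t ht) i j
  exact ⟨ys, hys, h.limit_mem_componentFunnel hb hc hy hys⟩

end Limits

end DesignFunctions
end Network

/-! ### Carathéodory fields with a continuous perturbation -/

/-- The Carathéodory conditions on a time-dependent map `f(t, x)`, `t ≥ t₀`: measurable in `t`,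
continuous in `x`, and bounded on compact sets of `x`, uniformly in `t`. -/
structure IsCaratheodory {E E' : Type*} [NormedAddCommGroup E] [NormedAddCommGroup E']
    (t₀ : ℝ) (f : ℝ → E → E') : Prop where
  measurable : ∀ x, AEStronglyMeasurable (fun t => f t x) (volume.restrict (Ici t₀))
  continuous : ∀ t, t₀ ≤ t → Continuous (f t)
  bounded : ∀ K : Set E, IsCompact K → ∃ C : ℝ, ∀ t, t₀ ≤ t → ∀ x ∈ K, ‖f t x‖ ≤ C

theorem aestronglyMeasurable_pi {ι α : Type*} [Finite ι] [MeasurableSpace α] {μ : Measure α}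
    {E : ι → Type*} [∀ i, NormedAddCommGroup (E i)] {f : α → ∀ i, E i}
    (hf : ∀ i, AEStronglyMeasurable (fun a => f a i) μ) : AEStronglyMeasurable f μ := by
  classical
  cases nonempty_fintype ι
  have hsum : f = fun a => ∑ i, Pi.single i (f a i) :=
    funext fun a => (Finset.univ_sum_single (f a)).symm
  rw [hsum]
  exact Finset.aestronglyMeasurable_fun_sum _ fun i _ =>
    (continuous_single i).comp_aestronglyMeasurable (hf i)

section Perturbation

variable {X : Type*} [NormedAddCommGroup X] [NormedSpace ℝ X] [FiniteDimensional ℝ X]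
  {f g : ℝ → X → X} {D : Set (ℝ × X)} {t₀ b : ℝ} {ξ : X}

theorem IsCaratheodory.exists_eventually_norm_add_le (hf : IsCaratheodory t₀ f)
    (hg : ContinuousOn (fun q : ℝ × X => g q.1 q.2) (D ∩ Ici t₀ ×ˢ univ)) (hb : t₀ ≤ b)
    (hD : D ∈ 𝓝[Ici t₀ ×ˢ univ] (b, ξ)) :
    ∃ C, ∀ᶠ q in 𝓝[Ici t₀ ×ˢ univ] (b, ξ), q ∈ D ∧ ‖(f + g) q.1 q.2‖ ≤ C := by
  have := FiniteDimensional.proper_real X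
  have hbξ : (b, ξ) ∈ Ici t₀ ×ˢ (univ : Set X) := ⟨hb, mem_univ ξ⟩
  obtain ⟨A, hA⟩ := hf.bounded _ (isCompact_closedBall ξ 1)
  have hnear : ∀ᶠ q in 𝓝[Ici t₀ ×ˢ univ] (b, ξ), q.2 ∈ Metric.closedBall ξ 1 :=
    nhdsWithin_le_nhds (continuous_snd.continuousAt.eventually_mem
      (Metric.closedBall_mem_nhds ξ one_pos))
  have hgb : ∀ᶠ q in 𝓝[Ici t₀ ×ˢ univ] (b, ξ), ‖g q.1 q.2‖ < ‖g b ξ‖ + 1 := by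
    have hlim := (hg (b, ξ) ⟨mem_of_mem_nhdsWithin hbξ hD, hbξ⟩).norm
    rw [ContinuousWithinAt, nhdsWithin_inter_of_mem hD] at hlim
    exact hlim.eventually_lt_const (lt_add_one _)
  refine ⟨A + (‖g b ξ‖ + 1), ?_⟩
  filter_upwards [hD, hnear, hgb, self_mem_nhdsWithin] with q hqD hqξ hqg hqt
  exact ⟨hqD, norm_add_le_of_le (hA q.1 hqt.1 q.2 hqξ) hqg.le⟩

theorem IsCaratheodory.exists_local_solution (hf : IsCaratheodory t₀ f)
    (hg : ContinuousOn (fun q : ℝ × X => g q.1 q.2) (D ∩ Ici t₀ ×ˢ univ)) (hb : t₀ ≤ b)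
    (hD : D ∈ 𝓝[Ici t₀ ×ˢ univ] (b, ξ)) :
    ∃ (T : ℝ) (x : ℝ → X), b < T ∧ x b = ξ ∧ IsSolutionOn (f + g) D b T x := by
  obtain ⟨C, hC⟩ := hf.exists_eventually_norm_add_le hg hb hD
  obtain ⟨ε, hε, hball⟩ := Metric.mem_nhdsWithin_iff.1 hC
  have hIcc : Icc b (b + ε / 2) ⊆ Ici t₀ := fun t ht => hb.trans ht.1
  have hmem : ∀ t ∈ Icc b (b + ε / 2), ∀ η ∈ Metric.closedBall ξ (ε / 2),
      (t, η) ∈ D ∧ ‖(f + g) t η‖ ≤ C := by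
    refine fun t ht η hη => hball ⟨?_, hIcc ht, mem_univ η⟩
    have htb : dist t b < ε := by
      rw [Real.dist_eq, abs_of_nonneg (sub_nonneg.2 ht.1)]
      linarith [ht.2]
    exact max_lt htb ((Metric.mem_closedBall.1 hη).trans_lt (half_lt_self hε))
  refine FunnelCoupling.exists_local_solution (lt_add_of_pos_right b (half_pos hε)) (half_pos hε)
    (fun t ht η hη => (hmem t ht η hη).1) (fun t ht η hη => (hmem t ht η hη).2)
    (fun t ht => (hf.continuous t (hIcc ht)).continuousOn.add ?_) fun η hη => ?_
  · exact hg.comp (f := fun η => (t, η)) (by fun_prop)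
      fun η hη => ⟨(hmem t ht η hη).1, hIcc ht, mem_univ η⟩
  · refine ((hf.measurable η).mono_measure (Measure.restrict_mono hIcc le_rfl)).add ?_
    exact (hg.comp (f := fun t => (t, η)) (by fun_prop)
      fun t ht => ⟨(hmem t ht η hη).1, hIcc ht, mem_univ η⟩).aestronglyMeasurable measurableSet_Icc

theorem IsMaximalSolution.not_tendsto (hf : IsCaratheodory t₀ f)
    (hg : ContinuousOn (fun q : ℝ × X => g q.1 q.2) (D ∩ Ici t₀ ×ˢ univ)) {x : ℝ → X}
    (hx : IsMaximalSolution (f + g) D t₀ b x) (hD : D ∈ 𝓝[Ici t₀ ×ˢ univ] (b, ξ)) :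
    ¬Tendsto x (𝓝[<] b) (𝓝 ξ) := by
  intro hlim
  have hb : t₀ < b := EReal.coe_lt_coe_iff.1 hx.lt
  obtain ⟨T, y, hbT, hyb, hy⟩ := hf.exists_local_solution hg hb.le hD
  obtain ⟨C, hC⟩ := hf.exists_eventually_norm_add_le hg hb.le hD
  have hgraph : Tendsto (fun t => (t, x t)) (𝓝[<] b) (𝓝[Ici t₀ ×ˢ univ] (b, ξ)) := by
    refine tendsto_nhdsWithin_iff.2 ⟨(tendsto_id.mono_left nhdsWithin_le_nhds).prodMk_nhds hlim, ?_⟩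
    filter_upwards [Ioo_mem_nhdsLT hb] with t ht using ⟨ht.1.le, mem_univ _⟩
  obtain ⟨s, hs, hsC⟩ := mem_nhdsLT_iff_exists_Ico_subset.1
    ((hgraph.eventually hC).and (Ioo_mem_nhdsLT hb))
  have hs' : s ∈ Ico t₀ b := ⟨(hsC ⟨le_rfl, hs⟩).2.1.le, hs⟩
  exact hx.not_exists_continuation hs'
    (fun t ht => (hsC ht).1.2.trans (Real.le_coe_toNNReal C)) hlim hbT hyb hy

end Perturbation

namespace Network

variable {N m : ℕ} {n d : Fin N → ℕ} {S : Network N m n d} {t₀ t : ℝ} {x : State m n}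

/-! ### Deviations of the outputs from their mean -/

namespace DesignFunctions

theorem maxFunnel_nonneg (h : S.DesignFunctions t₀) (ht : t₀ ≤ t) : 0 ≤ S.maxFunnel t :=
  Real.iSup_nonneg fun q => (h.ψ_pos _ _ q.2.adj q.1 t ht).le

theorem syncBound_nonneg (h : S.DesignFunctions t₀) (ht : t₀ ≤ t) : 0 ≤ S.syncBound t :=
  mul_nonneg (Nat.cast_nonneg _) (h.maxFunnel_nonneg ht)

theorem exists_syncBound_le (h : S.DesignFunctions t₀) :
    ∃ C, ∀ t, t₀ ≤ t → S.syncBound t ≤ C := by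
  classical
  choose C hC using fun q : Fin m × S.graph.Dart => h.ψ_bounded _ _ q.2.adj q.1
  obtain ⟨R, hR⟩ := (Set.finite_range C).bddAbove
  refine ⟨S.graph.diam * max R 0, fun t ht => mul_le_mul_of_nonneg_left ?_ (Nat.cast_nonneg _)⟩
  exact Real.iSup_le (fun q => (hC q t ht).trans ((hR ⟨q, rfl⟩).trans (le_max_left R 0)))
    (le_max_right R 0)

end DesignFunctions

theorem ψ_le_maxFunnel {i j : Fin N} (hij : S.graph.Adj i j) (p : Fin m) (t : ℝ) :
    S.ψ i j p t ≤ S.maxFunnel t := by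
  classical
  exact le_ciSup (f := fun q : Fin m × S.graph.Dart => S.ψ q.2.fst q.2.snd q.1 t)
    (Set.finite_range _).bddAbove (p, ⟨(i, j), hij⟩)

theorem abs_sub_le_length_mul_maxFunnel (hx : (t, x) ∈ S.funnel) (p : Fin m) {i j : Fin N}
    (q : S.graph.Walk i j) : |(x i).1 p - (x j).1 p| ≤ q.length * S.maxFunnel t := by
  induction q with
  | nil => simp
  | @cons i k j hik q ih =>
    have hedge : |(x i).1 p - (x k).1 p| ≤ S.maxFunnel t :=
      (hx k i hik.symm p).le.trans (ψ_le_maxFunnel hik.symm p t)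
    calc |(x i).1 p - (x j).1 p|
        ≤ |(x i).1 p - (x k).1 p| + |(x k).1 p - (x j).1 p| := abs_sub_le _ _ _
      _ ≤ S.maxFunnel t + q.length * S.maxFunnel t := add_le_add hedge ih
      _ = (q.cons hik).length * S.maxFunnel t := by
        rw [SimpleGraph.Walk.length_cons]
        push_cast
        ring

theorem norm_sub_le_syncBound (hG : S.graph.Connected) (hΨ : S.DesignFunctions t₀) (ht : t₀ ≤ t)
    (hx : (t, x) ∈ S.funnel) (i j : Fin N) : ‖(x i).1 - (x j).1‖ ≤ S.syncBound t := by
  have := hG.nonempty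
  obtain ⟨q, hq⟩ := hG.exists_walk_length_eq_dist i j
  have hlen : (q.length : ℝ) ≤ S.graph.diam :=
    mod_cast hq.trans_le (SimpleGraph.dist_le_diam (SimpleGraph.connected_iff_ediam_ne_top.1 hG))
  exact (pi_norm_le_iff_of_nonneg (hΨ.syncBound_nonneg ht)).2 fun p =>
    (abs_sub_le_length_mul_maxFunnel hx p q).trans
      (mul_le_mul_of_nonneg_right hlen (hΨ.maxFunnel_nonneg ht))

/-- The deviations `yᵢ - (1/N) ∑ yⱼ` of the outputs from their mean. -/
def deviation (x : State m n) : Fin N → Vec m := fun i => (x i).1 - (blendedInit x).1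

theorem deviation_apply_eq (x : State m n) (i : Fin N) :
    deviation x i = (N : ℝ)⁻¹ • ∑ j, ((x i).1 - (x j).1) := by
  have hN : (N : ℝ) ≠ 0 := Nat.cast_ne_zero.2 i.pos.ne'
  simp only [deviation, blendedInit, Finset.sum_sub_distrib, smul_sub, Finset.sum_const,
    Finset.card_univ, Fintype.card_fin, ← Nat.cast_smul_eq_nsmul ℝ, smul_smul, inv_mul_cancel₀ hN,
    one_smul]

theorem norm_deviation_le (hG : S.graph.Connected) (hΨ : S.DesignFunctions t₀) (ht : t₀ ≤ t)
    (hx : (t, x) ∈ S.funnel) : ‖deviation x‖ ≤ S.syncBound t := by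
  refine (pi_norm_le_iff_of_nonneg (hΨ.syncBound_nonneg ht)).2 fun i => ?_
  have hN : (N : ℝ) ≠ 0 := Nat.cast_ne_zero.2 i.pos.ne'
  calc ‖deviation x i‖ = (N : ℝ)⁻¹ * ‖∑ j, ((x i).1 - (x j).1)‖ := by
        rw [deviation_apply_eq, norm_smul, norm_inv, Real.norm_natCast]
    _ ≤ (N : ℝ)⁻¹ * ∑ _j : Fin N, S.syncBound t := by
        gcongr
        exact norm_sum_le_of_le _ fun j _ => norm_sub_le_syncBound hG hΨ ht hx i j
    _ = S.syncBound t := by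
        rw [Finset.sum_const, Finset.card_univ, Fintype.card_fin, nsmul_eq_mul,
          inv_mul_cancel_left₀ hN]

theorem norm_apply_sub_le (x : State m n) (ξ : BlendedState m n) (i : Fin N) :
    ‖x i - (ξ.1, ξ.2 i)‖ ≤ ‖blendedInit x - ξ‖ + ‖deviation x‖ := by
  have hs : ‖(blendedInit x).1 - ξ.1‖ ≤ ‖blendedInit x - ξ‖ := norm_fst_le (blendedInit x - ξ)
  have hz : ‖(x i).2 - ξ.2 i‖ ≤ ‖blendedInit x - ξ‖ :=
    (norm_le_pi_norm (blendedInit x - ξ).2 i).trans (norm_snd_le _)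
  have hdev : ‖(x i).1 - (blendedInit x).1‖ ≤ ‖deviation x‖ := norm_le_pi_norm (deviation x) i
  have hy : ‖(x i).1 - ξ.1‖ ≤ ‖blendedInit x - ξ‖ + ‖deviation x‖ := by
    linarith [norm_sub_le_norm_sub_add_norm_sub (x i).1 (blendedInit x).1 ξ.1]
  exact max_le hy (hz.trans (le_add_of_nonneg_right (norm_nonneg _)))

theorem norm_le_norm_blendedInit_add (x : State m n) :
    ‖x‖ ≤ ‖blendedInit x‖ + ‖deviation x‖ := by
  refine (pi_norm_le_iff_of_nonneg (by positivity)).2 fun i => ?_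
  have hle := norm_apply_sub_le x 0 i
  rwa [sub_zero, Prod.fst_zero, Prod.snd_zero, Pi.zero_apply, Prod.mk_zero_zero, sub_zero] at hle

end Network

theorem IsRegular.isCaratheodory {E E' : Type*} [NormedAddCommGroup E] [NormedAddCommGroup E']
    {t₀ : ℝ} {f : ℝ → E → E'} (h : IsRegular t₀ f) : IsCaratheodory t₀ f where
  measurable := h.measurable
  continuous t ht := (h.locallyLipschitz t ht).continuous
  bounded := h.bounded

theorem IsSolutionOn.continuousOn_Ico {X : Type*} [NormedAddCommGroup X] [NormedSpace ℝ X]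
    {f : ℝ → X → X} {D : Set (ℝ × X)} {a : ℝ} {ω : EReal} {x : ℝ → X}
    (h : IsSolutionOn f D a ω x) : ContinuousOn x {t | a ≤ t ∧ (t : EReal) < ω} := by
  rintro t ⟨hat, htω⟩
  obtain ⟨T, htT, hTω⟩ := EReal.lt_iff_exists_real_btwn.1 htω
  have htT : t < T := EReal.coe_lt_coe_iff.1 htT
  refine (h.continuousOn (hat.trans htT.le) hTω t ⟨hat, htT.le⟩).mono_of_mem_nhdsWithin ?_
  filter_upwards [self_mem_nhdsWithin, nhdsWithin_le_nhds (Iio_mem_nhds htT)] with s hs hsT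
  exact ⟨hs.1, (mem_Iio.1 hsT).le⟩

theorem IsMaximalSolution.congr_rhs {X : Type*} [NormedAddCommGroup X] [NormedSpace ℝ X]
    {f g : ℝ → X → X} {D : Set (ℝ × X)} {a : ℝ} {ω : EReal} {x : ℝ → X}
    (h : IsMaximalSolution f D a ω x) (hfg : ∀ t, a ≤ t → g t = f t) :
    IsMaximalSolution g D a ω x where
  lt := h.lt
  isSolutionOn := h.isSolutionOn.congr_rhs h.isSolutionOn.mem_domain
    fun t hat _ => congrFun (hfg t hat) _
  maximal ω' y hy := h.maximal ω' y (hy.congr_rhs hy.mem_domain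
    fun t hat _ => (congrFun (hfg t hat) _).symm)

namespace Network

variable {N m : ℕ} {n d : Fin N → ℕ} {S : Network N m n d} {t₀ t : ℝ} {x : State m n}

/-! ### The closed loop as a perturbation of the uncoupled agents -/

/-- The right-hand side `(Fᵢ, Zᵢ)ᵢ` of the network without coupling. -/
def agentField (S : Network N m n d) (t : ℝ) (x : State m n) : State m n :=
  fun i => (S.F i t (x i).1 (x i).2, S.Z i t (x i).2 (x i).1)

/-- The contribution `(∑_{j ∈ 𝒩ᵢ} uᵢⱼ, 0)ᵢ` of the coupling to the closed loop once the gain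
matrices have cancelled. -/
def couplingField (S : Network N m n d) (t : ℝ) (x : State m n) : State m n :=
  fun i => (fun p => ∑ j, S.edgeForce p t (fun k => (x k).1 p) i j, 0)

theorem closedLoop_eq_agentField_add_couplingField (hΓ : ∀ i w, IsUnit (S.Γ i t w)) :
    S.closedLoop t = S.agentField t + S.couplingField t := by
  classical
  ext x i p
  · simp only [closedLoop, coupling, agentField, couplingField, Matrix.mulVec_mulVec,
      Matrix.mul_nonsing_inv _ ((Matrix.isUnit_iff_isUnit_det _).1 (hΓ i _)), Matrix.one_mulVec,
      Pi.add_apply, Prod.fst_add, Finset.sum_apply, Finset.sum_filter, ite_apply]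
    rfl
  · exact (add_zero _).symm

theorem OpenLoop.isCaratheodory_agentField (h : S.OpenLoop t₀) :
    IsCaratheodory t₀ S.agentField where
  measurable x := aestronglyMeasurable_pi fun i =>
    ((h.F i).measurable (x i)).prodMk ((h.Z i).measurable (x i))
  continuous t ht := continuous_pi fun i =>
    (((h.F i).isCaratheodory.continuous t ht).prodMk
      ((h.Z i).isCaratheodory.continuous t ht)).comp (continuous_apply i)
  bounded K hK := by
    choose A hA using fun i => (h.F i).bounded _ (hK.image (continuous_apply i))
    choose B hB using fun i => (h.Z i).bounded _ (hK.image (continuous_apply i))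
    obtain ⟨C, hC⟩ := (Set.finite_range fun i => max (A i) (B i)).bddAbove
    refine ⟨max C 0, fun t ht x hx =>
      (pi_norm_le_iff_of_nonneg (le_max_right C 0)).2 fun i => ?_⟩
    exact (max_le_max (hA i t ht _ ⟨x, hx, rfl⟩) (hB i t ht _ ⟨x, hx, rfl⟩)).trans
      ((hC ⟨i, rfl⟩).trans (le_max_left C 0))

theorem mem_componentFunnel (hx : (t, x) ∈ S.funnel) (p : Fin m) :
    (t, fun k => (x k).1 p) ∈ S.componentFunnel p :=
  fun i j hij => hx i j hij p

theorem DesignFunctions.funnel_mem_nhdsWithin (h : S.DesignFunctions t₀) (ht : t₀ ≤ t)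
    (hx : (t, x) ∈ S.funnel) : S.funnel ∈ 𝓝[Ici t₀ ×ˢ univ] (t, x) := by
  refine eventually_all.2 fun i => eventually_all.2 fun j => eventually_all.2 fun hij =>
    eventually_all.2 fun p => ?_
  have hψ : ContinuousWithinAt (fun q : ℝ × State m n => S.ψ i j p q.1) (Ici t₀ ×ˢ univ) (t, x) :=
    ((h.ψ_contDiff i j hij p).continuousOn t ht).comp continuousWithinAt_fst fun q hq => hq.1
  have hdiff : Continuous fun q : ℝ × State m n => |(q.2 j).1 p - (q.2 i).1 p| := by fun_prop
  exact hdiff.continuousWithinAt.eventually_lt hψ (hx i j hij p)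

theorem DesignFunctions.continuousOn_couplingField (h : S.DesignFunctions t₀) :
    ContinuousOn (fun q : ℝ × State m n => S.couplingField q.1 q.2)
      (S.funnel ∩ Ici t₀ ×ˢ univ) := by
  refine continuousOn_pi.2 fun i => (continuousOn_pi.2 fun p =>
    continuousOn_finsetSum _ fun j _ => ?_).prodMk continuousOn_const
  by_cases hij : S.graph.Adj i j
  · simp only [edgeForce_of_adj hij]
    refine (h.μ_continuousOn i j hij p).comp (ContinuousOn.div ?_ ?_ ?_) ?_
    · exact Continuous.continuousOn (by fun_prop)
    · exact (h.ψ_contDiff i j hij p).continuousOn.comp continuousOn_fst fun q hq => hq.2.1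
    · exact fun q hq => (h.ψ_pos i j hij p q.1 hq.2.1).ne'
    · exact fun q hq => div_mem_Ioo_of_abs_lt (hq.1 i j hij p)
  · simp only [edgeForce_of_not_adj hij]
    exact continuousOn_const

/-! ### The blended dynamics driven by the deviations -/

/-- `blendedInit` as a continuous linear map. -/
def blendedInitCLM (m : ℕ) (n : Fin N → ℕ) : State m n →L[ℝ] BlendedState m n :=
  ((N : ℝ)⁻¹ • ∑ i, (ContinuousLinearMap.fst ℝ (Vec m) (Vec (n i))).comp
    (ContinuousLinearMap.proj i)).prod
    (ContinuousLinearMap.pi fun i => (ContinuousLinearMap.snd ℝ (Vec m) (Vec (n i))).comp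
      (ContinuousLinearMap.proj i))

theorem blendedInitCLM_apply (x : State m n) : blendedInitCLM m n x = blendedInit x := by
  ext <;> simp [blendedInitCLM, blendedInit]

theorem continuous_deviation : Continuous (deviation (m := m) (n := n)) := by
  unfold deviation
  simp only [← blendedInitCLM_apply]
  fun_prop

theorem blendedInit_agentField (t : ℝ) (x : State m n) :
    blendedInit (S.agentField t x) = S.perturbedBlended t (blendedInit x) (deviation x) := by
  simp only [blendedInit, agentField, perturbedBlended, deviation, add_sub_cancel]

theorem DesignFunctions.blendedInit_couplingField (h : S.DesignFunctions t₀) (ht : t₀ ≤ t)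
    (hx : (t, x) ∈ S.funnel) : blendedInit (S.couplingField t x) = 0 := by
  have hsum : ∑ i, (S.couplingField t x i).1 = 0 := by
    ext p
    have hanti := sum_mul_sum_antisymm
      (h.edgeForce_antisymm ht (mem_componentFunnel hx p)) (fun _ => 1)
    simpa [couplingField] using hanti
  rw [blendedInit, hsum, smul_zero]
  rfl

/-- The deviations of the outputs along `x` on `[t₀, ω)`, extended by zero to an input of the
perturbed blended dynamics. -/
def syncError (t₀ : ℝ) (ω : EReal) (x : ℝ → State m n) : ℝ → Fin N → Vec m :=
  indicator {t | t₀ ≤ t ∧ (t : EReal) < ω} fun t => deviation (x t)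

section Solution

variable {f : ℝ → State m n → State m n} {ω : EReal} {x : ℝ → State m n}

theorem syncError_of_lt (ht : t₀ ≤ t) (htω : (t : EReal) < ω) :
    syncError t₀ ω x t = deviation (x t) :=
  indicator_of_mem (s := {t : ℝ | t₀ ≤ t ∧ (t : EReal) < ω}) ⟨ht, htω⟩ _

theorem norm_syncError_le (hG : S.graph.Connected) (hΨ : S.DesignFunctions t₀)
    (hx : IsSolutionOn f S.funnel t₀ ω x) (ht : t₀ ≤ t) :
    ‖syncError t₀ ω x t‖ ≤ S.syncBound t := by
  by_cases htω : (t : EReal) < ω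
  · rw [syncError_of_lt ht htω]
    exact norm_deviation_le hG hΨ ht (hx.mem_domain t ht htω)
  · rw [syncError, indicator_of_notMem fun hmem => htω hmem.2, norm_zero]
    exact hΨ.syncBound_nonneg ht

theorem isAdmissibleInput_syncError (hG : S.graph.Connected) (hΨ : S.DesignFunctions t₀)
    (hx : IsSolutionOn f S.funnel t₀ ω x) : IsAdmissibleInput t₀ (syncError t₀ ω x) where
  measurable := by
    have hω : MeasurableSet {t : ℝ | t₀ ≤ t ∧ (t : EReal) < ω} :=
      measurableSet_Ici.inter (measurable_coe_real_ereal measurableSet_Iio)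
    exact ((aestronglyMeasurable_indicator_iff hω).2 ((continuous_deviation.comp_continuousOn
      hx.continuousOn_Ico).aestronglyMeasurable hω)).mono_measure Measure.restrict_le_self
  locallyBounded T := by
    obtain ⟨C, hC⟩ := hΨ.exists_syncBound_le
    refine ⟨C, ?_⟩
    filter_upwards [ae_restrict_mem measurableSet_Icc] with t ht
    exact (norm_syncError_le hG hΨ hx ht.1).trans (hC t ht.1)

theorem isSolutionOn_blendedInit (hΨ : S.DesignFunctions t₀)
    (hx : IsSolutionOn (S.agentField + S.couplingField) S.funnel t₀ ω x) :
    IsSolutionOn (fun t ξ => S.perturbedBlended t ξ (syncError t₀ ω x t)) univ t₀ ω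
      (fun t => blendedInit (x t)) := by
  refine isSolutionOn_iff.2 fun T hT hTω => ⟨mem_univ _, ?_⟩
  simp only [← blendedInitCLM_apply]
  refine ((hx.hasAEDerivOn hT hTω).clm_comp (blendedInitCLM m n)).congr_deriv fun t ht => ?_
  have htω : (t : EReal) < ω := (EReal.coe_lt_coe_iff.2 ht.2).trans hTω
  simp only [Pi.add_apply, map_add, blendedInitCLM_apply]
  rw [syncError_of_lt ht.1.le htω, blendedInit_agentField,
    hΨ.blendedInit_couplingField ht.1.le (hx.mem_domain t ht.1.le htω), add_zero]

end Solution

end Network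

theorem IsDeltaISS.eq_top_of_isMaximalSolution {X U : Type*} [NormedAddCommGroup X]
    [NormedSpace ℝ X] [NormedAddCommGroup U] {t₀ τ : ℝ} {f : ℝ → X → U → X} {β : ℝ → ℝ → ℝ}
    {γ : ℝ → ℝ} {u : ℝ → U} {ω : EReal} {x : ℝ → X} (h : IsDeltaISS t₀ f β γ) (hτ : t₀ ≤ τ)
    (hu : IsAdmissibleInput τ u)
    (hx : IsMaximalSolution (fun t ξ => f t ξ (u t)) univ τ ω x) : ω = ⊤ := by
  obtain ⟨x', hx'τ, hx'⟩ := h.global τ hτ (x τ) u hu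
  exact top_le_iff.1 (hx.maximal ⊤ x' hx' fun T hT hTω =>
    h.eq_of_isSolutionOn hτ hu hx.isSolutionOn hx' hx'τ hT hTω)

namespace Network

variable {N m : ℕ} {n d : Fin N → ℕ} {S : Network N m n d} {t₀ b : ℝ} {β : ℝ → ℝ → ℝ}
  {γ : ℝ → ℝ} {ω : EReal} {x : ℝ → State m n} {ξ : ℝ → BlendedState m n}

theorem perturbedBlended_zero (S : Network N m n d) :
    (fun t ξ => S.perturbedBlended t ξ 0) = S.blended := by
  ext1 t; ext1 ξ
  simp only [perturbedBlended, blended, Pi.zero_apply, add_zero]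

theorem exists_isSolutionOn_blended (hISS : IsDeltaISS t₀ S.perturbedBlended β γ)
    (ξ₀ : BlendedState m n) : ∃ ξ, ξ t₀ = ξ₀ ∧ IsSolutionOn S.blended univ t₀ ⊤ ξ := by
  rw [← perturbedBlended_zero]
  exact hISS.global t₀ le_rfl ξ₀ _ (isAdmissibleInput_zero t₀)

theorem eq_top_of_isMaximalSolution_blended (hISS : IsDeltaISS t₀ S.perturbedBlended β γ)
    (hξ : IsMaximalSolution S.blended univ t₀ ω ξ) : ω = ⊤ := by
  rw [← perturbedBlended_zero] at hξ
  exact hISS.eq_top_of_isMaximalSolution le_rfl (isAdmissibleInput_zero t₀) hξ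

/-! ### Solutions of the closed loop are global -/

theorem exists_continuousOn_eq_blendedInit (hG : S.graph.Connected) (hΨ : S.DesignFunctions t₀)
    (hISS : IsDeltaISS t₀ S.perturbedBlended β γ) (hb : t₀ ≤ b)
    (hx : IsSolutionOn (S.agentField + S.couplingField) S.funnel t₀ b x) :
    ∃ ξ, ContinuousOn ξ (Icc t₀ b) ∧ ∀ t ∈ Ico t₀ b, ξ t = blendedInit (x t) := by
  have hu := isAdmissibleInput_syncError hG hΨ hx
  obtain ⟨ξ, hξ₀, hξ⟩ := hISS.global t₀ le_rfl (blendedInit (x t₀)) _ hu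
  exact ⟨ξ, hξ.continuousOn hb (EReal.coe_lt_top b), fun t ht =>
    hISS.eq_of_isSolutionOn le_rfl hu (isSolutionOn_blendedInit hΨ hx) hξ hξ₀ ht.1
      (EReal.coe_lt_coe_iff.2 ht.2)⟩

theorem exists_norm_le_of_eq_blendedInit (hG : S.graph.Connected) (hΨ : S.DesignFunctions t₀)
    (hx : ∀ t ∈ Ico t₀ b, (t, x t) ∈ S.funnel) (hξ : ContinuousOn ξ (Icc t₀ b))
    (hξx : ∀ t ∈ Ico t₀ b, ξ t = blendedInit (x t)) : ∃ R, ∀ t ∈ Ico t₀ b, ‖x t‖ ≤ R := by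
  obtain ⟨R, hR⟩ := isCompact_Icc.exists_bound_of_continuousOn hξ
  obtain ⟨C, hC⟩ := hΨ.exists_syncBound_le
  refine ⟨R + C, fun t ht => (norm_le_norm_blendedInit_add (x t)).trans (add_le_add ?_ ?_)⟩
  · exact hξx t ht ▸ hR t (Ico_subset_Icc_self ht)
  · exact (norm_deviation_le hG hΨ ht.1 (hx t ht)).trans (hC t ht.1)

/-- The `p`-th output component of agent `i` as a continuous linear functional. -/
def outputCLM (m : ℕ) (n : Fin N → ℕ) (i : Fin N) (p : Fin m) : State m n →L[ℝ] ℝ :=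
  (ContinuousLinearMap.proj (φ := fun _ : Fin m => ℝ) p).comp
    ((ContinuousLinearMap.fst ℝ (Vec m) (Vec (n i))).comp (ContinuousLinearMap.proj i))

theorem exists_isCoupledOn_output (hf : IsCaratheodory t₀ S.agentField)
    (hΨ : S.DesignFunctions t₀)
    (hx : IsSolutionOn (S.agentField + S.couplingField) S.funnel t₀ b x) {R : ℝ}
    (hR : ∀ t ∈ Ico t₀ b, ‖x t‖ ≤ R) : ∃ M, ∀ p : Fin m,
    IsCoupledOn (fun i t => (x t i).1 p) (fun i t => (S.agentField t (x t) i).1 p)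
      (fun i j t => S.edgeForce p t (fun k => (x t k).1 p) i j) M t₀ b := by
  obtain ⟨M, hM⟩ := hf.bounded _ (isCompact_closedBall 0 R)
  refine ⟨M, fun p => ⟨fun i T hT => ?_, fun i t ht => ?_, fun i j t ht => ?_⟩⟩
  · exact (hx.hasAEDerivOn hT.1 (EReal.coe_lt_coe_iff.2 hT.2)).clm_comp (outputCLM m n i p)
  · exact (norm_le_pi_norm _ p).trans ((norm_fst_le _).trans ((norm_le_pi_norm _ i).trans
      (hM t ht.1 (x t) (mem_closedBall_zero_iff.2 (hR t ht)))))
  · exact hΨ.edgeForce_antisymm ht.1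
      (mem_componentFunnel (hx.mem_domain t ht.1 (EReal.coe_lt_coe_iff.2 ht.2)) p) i j

theorem exists_tendsto_mem_funnel (hf : IsCaratheodory t₀ S.agentField)
    (hG : S.graph.Connected) (hΨ : S.DesignFunctions t₀)
    (hISS : IsDeltaISS t₀ S.perturbedBlended β γ) (hb : t₀ < b)
    (hx : IsSolutionOn (S.agentField + S.couplingField) S.funnel t₀ b x) :
    ∃ η, Tendsto x (𝓝[<] b) (𝓝 η) ∧ (b, η) ∈ S.funnel := by
  have hmem : ∀ t ∈ Ico t₀ b, (t, x t) ∈ S.funnel := fun t ht =>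
    hx.mem_domain t ht.1 (EReal.coe_lt_coe_iff.2 ht.2)
  obtain ⟨ξ, hξ, hξx⟩ := exists_continuousOn_eq_blendedInit hG hΨ hISS hb.le hx
  obtain ⟨R, hR⟩ := exists_norm_le_of_eq_blendedInit hG hΨ hmem hξ hξx
  obtain ⟨M, hM⟩ := exists_isCoupledOn_output hf hΨ hx hR
  choose y hy hyb using fun p => hΨ.exists_limit_mem_componentFunnel hb (hM p) (B := R)
    (fun i t ht => (norm_le_pi_norm _ p).trans ((norm_fst_le _).trans
      ((norm_le_pi_norm _ i).trans (hR t ht))))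
    (fun t ht => mem_componentFunnel (hmem t ht) p)
  have hz : Tendsto (fun t => (blendedInit (x t)).2) (𝓝[<] b) (𝓝 (ξ b).2) := by
    have hξb : Tendsto ξ (𝓝[<] b) (𝓝 (ξ b)) := (hξ b (right_mem_Icc.2 hb.le)).mono_left
      (nhdsWithin_le_of_mem (Icc_mem_nhdsLT hb))
    refine ((continuous_snd.tendsto _).comp hξb).congr' ?_
    filter_upwards [Ico_mem_nhdsLT hb] with t ht
    exact congrArg Prod.snd (hξx t ht)
  refine ⟨fun i => (fun p => y p i, (ξ b).2 i), tendsto_pi_nhds.2 fun i => ?_,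
    fun i j hij p => hyb p i j hij⟩
  exact (tendsto_pi_nhds.2 fun p => hy p i).prodMk_nhds (tendsto_pi_nhds.1 hz i)

theorem eq_top_of_isMaximalSolution (hf : IsCaratheodory t₀ S.agentField)
    (hG : S.graph.Connected) (hΨ : S.DesignFunctions t₀)
    (hISS : IsDeltaISS t₀ S.perturbedBlended β γ)
    (hx : IsMaximalSolution (S.agentField + S.couplingField) S.funnel t₀ ω x) : ω = ⊤ := by
  induction ω with
  | bot => exact absurd hx.lt not_lt_bot
  | top => rfl
  | coe b =>
    have hb : t₀ < b := EReal.coe_lt_coe_iff.1 hx.lt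
    obtain ⟨η, hη, hηb⟩ := exists_tendsto_mem_funnel hf hG hΨ hISS hb hx.isSolutionOn
    exact absurd hη
      (hx.not_tendsto hf hΨ.continuousOn_couplingField (hΨ.funnel_mem_nhdsWithin hb.le hηb))

theorem exists_isSolutionOn (hf : IsCaratheodory t₀ S.agentField)
    (hG : S.graph.Connected) (hΨ : S.DesignFunctions t₀)
    (hISS : IsDeltaISS t₀ S.perturbedBlended β γ) {x₀ : State m n} (hx₀ : (t₀, x₀) ∈ S.funnel) :
    ∃ x, x t₀ = x₀ ∧ IsSolutionOn (S.agentField + S.couplingField) S.funnel t₀ ⊤ x := by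
  obtain ⟨T, x', hT, rfl, hx'⟩ := hf.exists_local_solution hΨ.continuousOn_couplingField le_rfl
    (hΨ.funnel_mem_nhdsWithin le_rfl hx₀)
  obtain ⟨ω, x, hx, hmax⟩ := hx'.exists_isMaximalSolution (EReal.coe_lt_coe_iff.2 hT)
  obtain rfl := eq_top_of_isMaximalSolution hf hG hΨ hISS hmax
  exact ⟨x, hx, hmax.isSolutionOn⟩

/-! ### Distance to the blended dynamics -/

theorem exists_norm_blendedInit_sub_le (hG : S.graph.Connected) (hΨ : S.DesignFunctions t₀)
    (hISS : IsDeltaISS t₀ S.perturbedBlended β γ) {w : ℝ → ℝ} (hw_anti : AntitoneOn w (Ici 0))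
    (hw : ∀ r, 0 ≤ r → 0 < w r) : ∃ γ', ClassKInfty γ' ∧ ∀ x ξ,
      IsSolutionOn (S.agentField + S.couplingField) S.funnel t₀ ⊤ x →
      IsSolutionOn S.blended univ t₀ ⊤ ξ → ξ t₀ = blendedInit (x t₀) → ∀ t, t₀ ≤ t →
      ‖blendedInit (x t) - ξ t‖ ≤ γ' (⨆ s : Ico t₀ t, S.syncBound s * w (t - s)) := by
  obtain ⟨C, hC⟩ := hΨ.exists_syncBound_le
  obtain ⟨γ', hγ', hle⟩ := hISS.exists_fading_memory_gain hw_anti hw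
    ((hΨ.syncBound_nonneg le_rfl).trans (hC t₀ le_rfl))
  refine ⟨γ', hγ', fun x ξ hx hξ hξ₀ => ?_⟩
  rw [← perturbedBlended_zero] at hξ
  refine hle S.syncBound _ _ ξ _ hC (isAdmissibleInput_zero t₀)
    (isAdmissibleInput_syncError hG hΨ hx) (fun t ht => ?_) hξ (isSolutionOn_blendedInit hΨ hx)
    hξ₀.symm
  rw [sub_zero]
  exact norm_syncError_le hG hΨ hx ht

end Network

end FunnelCoupling

end

open FunnelCoupling Network in
theorem corollary1_general {N m : ℕ} {n d : Fin N → ℕ} {S : Network N m n d} {t₀ : ℝ}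
    {β : ℝ → ℝ → ℝ} {γhat : ℝ → ℝ} (hf : IsCaratheodory t₀ S.agentField)
    (hΓ : ∀ i t, t₀ ≤ t → ∀ w, IsUnit (S.Γ i t w)) (hG : S.graph.Connected)
    (hΨ : S.DesignFunctions t₀) (hISS : IsDeltaISS t₀ S.perturbedBlended β γhat)
    {w : ℝ → ℝ} (hw_anti : AntitoneOn w (Ici 0)) (hw : ∀ r, 0 ≤ r → 0 < w r) :
    ∃ γ : ℝ → ℝ, ClassKInfty γ ∧ ∀ x₀ : State m n, (t₀, x₀) ∈ S.funnel →
      (∃ x, x t₀ = x₀ ∧ IsSolutionOn S.closedLoop S.funnel t₀ ⊤ x) ∧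
      (∃ ξ, ξ t₀ = blendedInit x₀ ∧ IsSolutionOn S.blended univ t₀ ⊤ ξ) ∧
      ∀ (ω : EReal) (x : ℝ → State m n) (ωhat : EReal) (ξ : ℝ → BlendedState m n),
        x t₀ = x₀ → IsMaximalSolution S.closedLoop S.funnel t₀ ω x →
        ξ t₀ = blendedInit x₀ → IsMaximalSolution S.blended univ t₀ ωhat ξ →
        ω = ⊤ ∧ ωhat = ⊤ ∧ ∀ (i : Fin N) (t : ℝ), t₀ ≤ t →
          ‖x t i - ((ξ t).1, (ξ t).2 i)‖ ≤
            γ (⨆ s : Ico t₀ t, S.syncBound s * w (t - s)) + S.syncBound t := by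
  have hfield : ∀ t, t₀ ≤ t → S.closedLoop t = (S.agentField + S.couplingField) t :=
    fun t ht => closedLoop_eq_agentField_add_couplingField fun i => hΓ i t ht
  obtain ⟨γ', hγ', hle⟩ := exists_norm_blendedInit_sub_le hG hΨ hISS hw_anti hw
  refine ⟨γ', hγ', fun x₀ hx₀ => ⟨?_, exists_isSolutionOn_blended hISS _, ?_⟩⟩
  · obtain ⟨x, hxt₀, hx⟩ := exists_isSolutionOn hf hG hΨ hISS hx₀
    exact ⟨x, hxt₀, hx.congr_rhs hx.mem_domain fun t ht _ => congrFun (hfield t ht) _⟩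
  rintro ω x ωhat ξ rfl hx hξ₀ hξ
  replace hx := hx.congr_rhs fun t ht => (hfield t ht).symm
  obtain rfl := eq_top_of_isMaximalSolution hf hG hΨ hISS hx
  obtain rfl := eq_top_of_isMaximalSolution_blended hISS hξ
  refine ⟨rfl, rfl, fun i t ht => (norm_apply_sub_le (x t) (ξ t) i).trans (add_le_add ?_ ?_)⟩
  · exact hle x ξ hx.isSolutionOn hξ.isSolutionOn hξ₀ t ht
  · exact norm_deviation_le hG hΨ ht (hx.isSolutionOn.mem_domain t ht (EReal.coe_lt_top t))

theorem corollary1 {N m : ℕ} {n d : Fin N → ℕ} (S : FunnelCoupling.Network N m n d) (t₀ : ℝ)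
    (hOpen : S.OpenLoop t₀) (hGain : S.GainMatrix t₀) (hGraph : S.graph.Connected)
    (hDesign : S.DesignFunctions t₀) (hEscape : S.NoFiniteEscape t₀)
    (β : ℝ → ℝ → ℝ) (γhat : ℝ → ℝ)
    (hISS : FunnelCoupling.IsDeltaISS t₀ S.perturbedBlended β γhat)
    (w : ℝ → ℝ) (hw_anti : AntitoneOn w (Set.Ici 0))
    (hw_mem : ∀ r, 0 ≤ r → w r ∈ Set.Ioc (0 : ℝ) 1)
    (hw_lim : Filter.Tendsto w Filter.atTop (nhds 0)) :
    ∃ γ : ℝ → ℝ, FunnelCoupling.ClassKInfty γ ∧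
      ∀ x₀ : FunnelCoupling.Network.State m n, (t₀, x₀) ∈ S.funnel →
        -- global solutions of the closed loop and of the blended dynamics exist
        (∃ x, x t₀ = x₀ ∧ FunnelCoupling.IsSolutionOn S.closedLoop S.funnel t₀ ⊤ x) ∧
        (∃ ξ, ξ t₀ = FunnelCoupling.Network.blendedInit x₀ ∧
          FunnelCoupling.IsSolutionOn S.blended Set.univ t₀ ⊤ ξ) ∧
        -- all maximal solutions are global and satisfy the estimate
        ∀ (ω : EReal) (x : ℝ → FunnelCoupling.Network.State m n)
          (ωhat : EReal) (ξ : ℝ → FunnelCoupling.Network.BlendedState m n),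
          x t₀ = x₀ →
          FunnelCoupling.IsMaximalSolution S.closedLoop S.funnel t₀ ω x →
          ξ t₀ = FunnelCoupling.Network.blendedInit x₀ →
          FunnelCoupling.IsMaximalSolution S.blended Set.univ t₀ ωhat ξ →
          ω = ⊤ ∧ ωhat = ⊤ ∧
          ∀ (i : Fin N) (t : ℝ), t₀ ≤ t →
            ‖x t i - ((ξ t).1, (ξ t).2 i)‖ ≤
              γ (⨆ s : Set.Ico t₀ t, S.syncBound s * w (t - s)) + S.syncBound t :=
  corollary1_general hOpen.isCaratheodory_agentField hGain.isUnit hGraph hDesign hISS hw_anti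
    fun r hr => (hw_mem r hr).1
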